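/- Let $\mathcal G$ be a metric graph with a finite or countable vertex set $\mathcal V$ and a finite or countable set $\mathcal E$ of directed edges; each edge $e$ has an initial vertex $e_o$, a terminal vertex $e_i$ and a length $|e|\in(0,\infty)$, and is identified with the interval $(0,|e|)$, the endpoint $0$ corresponding to $e_o$ and $|e|$ to $e_i$. In $L^2(\mathcal G)=\bigoplus_{e\in\mathcal E}L^2(e)$ consider the orthogonal direct sums $$\mathbf H_{\min}=\bigoplus_{e}\mathrm H_{e,\min},\qquad \mathbf H_{\max}=\bigoplus_{e}\mathrm H_{e,\max},$$ where $\mathrm H_{e,\min}$ and $\mathrm H_{e,\max}$ act as $-\frac{d^2}{dx^2}$ on $W^{2,2}_0(e)$ and on $W^{2,2}(e)$, respectively. For $f\in W^{2,2}(e)$ let $f(e_o),f(e_i)$ be the boundary values of the continuous representative of $f$, and let $$f'(e_o)=\lim_{x\to e_o}\frac{f(x)-f(e_o)}{|x-e_o|},\qquad f'(e_i)=\lim_{x\to e_i}\frac{f(x)-f(e_i)}{|x-e_i|}$$ be its inward boundary derivatives. Put $R_e=\sqrt{|e|}\,I_2$, $Q_e=\frac1{|e|}\begin{pmatrix}-1&1\\1&-1\end{pmatrix}$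 and $$\Gamma_{0,e}f=R_e\begin{pmatrix}f(e_o)\\f(e_i)\end{pmatrix},\qquad \Gamma_{1,e}f=R_e^{-1}\left(\begin{pmatrix}f'(e_o)\\f'(e_i)\end{pmatrix}-Q_e\begin{pmatrix}f(e_o)\\f(e_i)\end{pmatrix}\right).$$ Terminology. Let $A$ be a densely defined closed symmetric operator in a Hilbert space $\mathfrak H$ with equal deficiency indices. A boundary triplet for $A^*$ consists of a Hilbert space $\mathcal H$ and linear maps $\Gamma_0,\Gamma_1\colon\operatorname{dom}(A^*)\to\mathcal H$, bounded with respect to the graph norm of $A^*$, such that $(A^*f,g)-(f,A^*g)=(\Gamma_1f,\Gamma_0g)-(\Gamma_0f,\Gamma_1g)$ for all $f,g\in\operatorname{dom}(A^*)$ and such that $f\mapsto(\Gamma_0f,\Gamma_1f)$ maps $\operatorname{dom}(A^*)$ onto $\mathcal H\times\mathcal H$. Its Weyl function assigns to each $z$ in the resolvent set of $A_0:=A^*\upharpoonright\ker\Gamma_0$ the bounded operator $M(z)=\Gamma_1\big(\Gamma_0\upharpoonright\ker(A^*-z)\big)^{-1}$ in $\mathcal H$. **Theorem.** Suppose $\sup_{e\in\mathcal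 E}|e|<\infty$ (the case $\inf_{e\in\mathcal E}|e|=0$ is allowed). Then $\mathbf H_{\min}$ is a densely defined closed symmetric operator with equal deficiency indices, $\mathbf H_{\min}^*=\mathbf H_{\max}$, and $$\mathcal H=\bigoplus_{e\in\mathcal E}\mathbb C^2,\qquad \Gamma_j=\bigoplus_{e\in\mathcal E}\Gamma_{j,e}\colon\operatorname{dom}(\mathbf H_{\max})\to\mathcal H,\quad j\in\{0,1\},$$ are well defined and form a boundary triplet for $\mathbf H_{\max}$. Its Weyl function $M$ is defined, with values in the bounded operators in $\mathcal H$, on the whole resolvent set of $\mathbf H_{\max}\upharpoonright\ker\Gamma_0$; this set contains $\mathbb C\setminus\mathbb R$, and for all $z\in\mathbb C\setminus\mathbb R$ $$M(z)=\bigoplus_{e\in\mathcal E}M_e(z),\qquad M_e(z)=R_e^{-1}\big(M_e^0(z)-Q_e\big)R_e^{-1},$$ $$M_e^0(z)=\sqrt z\begin{pmatrix}-\cot(|e|\sqrt z)&\csc(|e|\sqrt z)\\ \csc(|e|\sqrt z)&-\cot(|e|\sqrt z)\end{pmatrix},$$ with the principal branch of $\sqrt z$. -/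

import Mathlib

open MeasureTheory Set Filter Topology
open scoped ContDiff Matrix InnerProductSpace

namespace QuantumGraph

noncomputable section

/-! ### Unbounded operators, boundary triplets and Weyl functions -/

section Abstract

variable {H K : Type*} [NormedAddCommGroup H] [InnerProductSpace ℂ H]
  [NormedAddCommGroup K] [InnerProductSpace ℂ K]

/-- The subspace `ker (T - z)`, as a subspace of the domain of `T`. -/
def defectSpace (T : H →ₗ.[ℂ] H) (z : ℂ) : Submodule ℂ T.domain :=
  LinearMap.ker (T.toFun - z • T.domain.subtype)

/-- The resolvent set of an unbounded operator: `A - z` is a bijection from the domain of `A`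
onto the whole space, with bounded inverse. -/
def opResolventSet (A : H →ₗ.[ℂ] H) : Set ℂ :=
  {z | Function.Bijective (fun f : A.domain => A f - z • (f : H)) ∧
    ∃ C : ℝ, ∀ f : A.domain, ‖(f : H)‖ ≤ C * ‖A f - z • (f : H)‖}

/-- The restriction of `T` to the kernel of `Γ`. -/
def restrictKer (T : H →ₗ.[ℂ] H) (Γ : T.domain →ₗ[ℂ] K) : H →ₗ.[ℂ] H :=
  T.domRestrict ((LinearMap.ker Γ).map T.domain.subtype)

/-- `{K, Γ₀, Γ₁}` is a boundary triplet for the operator `T`, which is the adjoint of the densely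
defined closed symmetric operator `A` with equal deficiency indices (the spaces `ker (T - i)` and
`ker (T + i)` have the same Hilbert dimension, i.e. are isometrically isomorphic).
Mathlib's inner product is conjugate linear in the first variable. -/
structure IsBoundaryTriplet [CompleteSpace H] (A T : H →ₗ.[ℂ] H)
    (Γ₀ Γ₁ : T.domain →ₗ[ℂ] K) : Prop where
  dense : Dense (A.domain : Set H)
  closed : A.IsClosed
  symmetric : A.IsFormalAdjoint A
  adjoint_eq : A.adjoint = T
  deficiency : Nonempty (defectSpace T Complex.I ≃ₗᵢ[ℂ] defectSpace T (-Complex.I))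
  complete : CompleteSpace K
  bounded₀ : ∃ C : ℝ, ∀ f : T.domain, ‖Γ₀ f‖ ≤ C * (‖(f : H)‖ + ‖T f‖)
  bounded₁ : ∃ C : ℝ, ∀ f : T.domain, ‖Γ₁ f‖ ≤ C * (‖(f : H)‖ + ‖T f‖)
  green : ∀ f g : T.domain,
    inner ℂ (g : H) (T f) - inner ℂ (T g) (f : H) =
      inner ℂ (Γ₀ g) (Γ₁ f) - inner ℂ (Γ₁ g) (Γ₀ f)
  surjective : Function.Surjective (fun f : T.domain => (Γ₀ f, Γ₁ f))

/-- `M` is the Weyl function `z ↦ Γ₁ (Γ₀ ↾ ker (T - z))⁻¹`, a function from the resolvent set of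
`A₀ = T ↾ ker Γ₀` to the bounded operators in `K`. -/
def IsWeylFunction (T : H →ₗ.[ℂ] H) (Γ₀ Γ₁ : T.domain →ₗ[ℂ] K)
    (M : opResolventSet (restrictKer T Γ₀) → (K →L[ℂ] K)) : Prop :=
  ∀ z : opResolventSet (restrictKer T Γ₀),
    Function.Bijective (fun f : defectSpace T z => Γ₀ f) ∧
      ∀ f : defectSpace T z, M z (Γ₀ f) = Γ₁ f

end Abstract

/-! ### Direct sums of unbounded operators -/

section DirectSum

variable {ι : Type*} {H K : ι → Type*}
  [∀ i, NormedAddCommGroup (H i)] [∀ i, InnerProductSpace ℂ (H i)]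
  [∀ i, NormedAddCommGroup (K i)] [∀ i, InnerProductSpace ℂ (K i)]

/-- The orthogonal direct sum of unbounded operators `T i`, between Hilbert direct sums: it acts
componentwise on all `f` with `f i ∈ dom (T i)` for which the family `T i (f i)` is square
summable. -/
def directSum (T : ∀ i, H i →ₗ.[ℂ] K i) : lp H 2 →ₗ.[ℂ] lp K 2 where
  domain :=
    { carrier := {f | ∃ h : ∀ i, f i ∈ (T i).domain, Memℓp (fun i => T i ⟨f i, h i⟩) 2}
      zero_mem' := by
        refine ⟨fun i => (T i).domain.zero_mem, ?_⟩
        have : (fun i => T i ⟨(0 : lp H 2) i, (T i).domain.zero_mem⟩) = 0 := by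
          funext i
          exact (T i).map_zero
        rw [this]
        exact zero_memℓp
      add_mem' := by
        rintro f g ⟨hf, hf'⟩ ⟨hg, hg'⟩
        refine ⟨fun i => (T i).domain.add_mem (hf i) (hg i), ?_⟩
        have : (fun i => T i ⟨(f + g : lp H 2) i, (T i).domain.add_mem (hf i) (hg i)⟩)
            = (fun i => T i ⟨f i, hf i⟩) + (fun i => T i ⟨g i, hg i⟩) := by
          funext i
          exact (T i).map_add ⟨f i, hf i⟩ ⟨g i, hg i⟩
        rw [this]
        exact hf'.add hg'
      smul_mem' := by
        rintro c f ⟨hf, hf'⟩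
        refine ⟨fun i => (T i).domain.smul_mem c (hf i), ?_⟩
        have : (fun i => T i ⟨(c • f : lp H 2) i, (T i).domain.smul_mem c (hf i)⟩)
            = c • (fun i => T i ⟨f i, hf i⟩) := by
          funext i
          exact (T i).map_smul c ⟨f i, hf i⟩
        rw [this]
        exact hf'.const_smul c }
  toFun :=
    { toFun := fun f => ⟨fun i => T i ⟨(f : lp H 2) i, f.2.choose i⟩, f.2.choose_spec⟩
      map_add' := by
        intro f g
        ext i
        exact (T i).map_add ⟨(f : lp H 2) i, f.2.choose i⟩ ⟨(g : lp H 2) i, g.2.choose i⟩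
      map_smul' := by
        intro c f
        ext i
        exact (T i).map_smul c ⟨(f : lp H 2) i, f.2.choose i⟩ }

end DirectSum

/-! ### Sobolev spaces and second derivative operators on the interval `(0, l)` -/

/-- The Hilbert space `L²(0, l)`. -/
abbrev EdgeL2 (l : ℝ) : Type := Lp ℂ 2 (volume.restrict (Ioo 0 l))

/-- The space `C_c^∞(0, l)`. -/
structure IsTest (l : ℝ) (φ : ℝ → ℂ) : Prop where
  smooth : ContDiff ℝ ∞ φ
  compact : HasCompactSupport φ
  support : tsupport φ ⊆ Ioo 0 l

/-- `g` is the weak derivative of `f` on `(0, l)`. -/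
def HasWeakDeriv (l : ℝ) (f g : EdgeL2 l) : Prop :=
  ∀ φ : ℝ → ℂ, IsTest l φ →
    ∫ x in Ioo 0 l, f x * deriv φ x = - ∫ x in Ioo 0 l, g x * φ x

theorem IsTest.add {l : ℝ} {φ ψ : ℝ → ℂ} (hφ : IsTest l φ) (hψ : IsTest l ψ) :
    IsTest l (φ + ψ) :=
  ⟨hφ.smooth.add hψ.smooth, hφ.compact.add hψ.compact,
    (tsupport_add φ ψ).trans (union_subset hφ.support hψ.support)⟩

theorem IsTest.const_smul {l : ℝ} {φ : ℝ → ℂ} (hφ : IsTest l φ) (c : ℂ) :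
    IsTest l (c • φ) := by
  have h : tsupport (c • φ) ⊆ tsupport φ := closure_mono (Function.support_const_smul_subset c φ)
  exact ⟨hφ.smooth.const_smul c, hφ.compact.mono (Function.support_const_smul_subset c φ),
    h.trans hφ.support⟩

theorem IsTest.zero (l : ℝ) : IsTest l 0 :=
  ⟨contDiff_const, HasCompactSupport.zero, by simp⟩

theorem IsTest.deriv {l : ℝ} {φ : ℝ → ℂ} (hφ : IsTest l φ) : IsTest l (deriv φ) :=
  ⟨(contDiff_infty_iff_deriv.1 hφ.smooth).2, hφ.compact.deriv, tsupport_deriv_subset.trans hφ.support⟩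

theorem integrable_mul_test {l : ℝ} (f : EdgeL2 l) {φ : ℝ → ℂ} (hφ : IsTest l φ) :
    IntegrableOn (fun x => f x * φ x) (Ioo 0 l) := by
  have h1 : MemLp φ 2 (volume.restrict (Ioo 0 l)) :=
    (hφ.smooth.continuous.memLp_of_hasCompactSupport hφ.compact).restrict _
  exact (Lp.memLp f).integrable_mul h1

theorem HasWeakDeriv.add {l : ℝ} {f g f' g' : EdgeL2 l} (hf : HasWeakDeriv l f f')
    (hg : HasWeakDeriv l g g') : HasWeakDeriv l (f + g) (f' + g') := by
  intro φ hφ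
  have h1 : ∫ x in Ioo 0 l, (f + g : EdgeL2 l) x * deriv φ x
      = ∫ x in Ioo 0 l, (f x * deriv φ x + g x * deriv φ x) := by
    apply integral_congr_ae
    filter_upwards [Lp.coeFn_add f g] with x hx
    rw [hx, Pi.add_apply, add_mul]
  have h2 : ∫ x in Ioo 0 l, (f' + g' : EdgeL2 l) x * φ x
      = ∫ x in Ioo 0 l, (f' x * φ x + g' x * φ x) := by
    apply integral_congr_ae
    filter_upwards [Lp.coeFn_add f' g'] with x hx
    rw [hx, Pi.add_apply, add_mul]
  rw [h1, h2, integral_add (integrable_mul_test f hφ.deriv) (integrable_mul_test g hφ.deriv),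
    integral_add (integrable_mul_test f' hφ) (integrable_mul_test g' hφ), hf φ hφ, hg φ hφ,
    neg_add]

theorem HasWeakDeriv.const_smul {l : ℝ} {f f' : EdgeL2 l} (hf : HasWeakDeriv l f f') (c : ℂ) :
    HasWeakDeriv l (c • f) (c • f') := by
  intro φ hφ
  have h1 : ∫ x in Ioo 0 l, (c • f : EdgeL2 l) x * deriv φ x
      = ∫ x in Ioo 0 l, c * (f x * deriv φ x) := by
    apply integral_congr_ae
    filter_upwards [Lp.coeFn_smul c f] with x hx
    rw [hx, Pi.smul_apply, smul_eq_mul, mul_assoc]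
  have h2 : ∫ x in Ioo 0 l, (c • f' : EdgeL2 l) x * φ x
      = ∫ x in Ioo 0 l, c * (f' x * φ x) := by
    apply integral_congr_ae
    filter_upwards [Lp.coeFn_smul c f'] with x hx
    rw [hx, Pi.smul_apply, smul_eq_mul, mul_assoc]
  rw [h1, h2, integral_const_mul, integral_const_mul, hf φ hφ, mul_neg]

theorem HasWeakDeriv.zero (l : ℝ) : HasWeakDeriv l 0 0 := by
  intro φ _
  have h : ∀ ψ : ℝ → ℂ, ∫ x in Ioo 0 l, (0 : EdgeL2 l) x * ψ x = 0 := by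
    intro ψ
    rw [← integral_zero ℝ ℂ (μ := volume.restrict (Ioo 0 l))]
    apply integral_congr_ae
    filter_upwards [Lp.coeFn_zero ℂ 2 (volume.restrict (Ioo 0 l))] with x hx
    rw [hx, Pi.zero_apply, zero_mul]
  rw [h, h, neg_zero]

/-- The weak derivative is unique. -/
theorem HasWeakDeriv.unique {l : ℝ} {f g h : EdgeL2 l} (hg : HasWeakDeriv l f g)
    (hh : HasWeakDeriv l f h) : g = h := by
  have hloc : ∀ u : EdgeL2 l, LocallyIntegrableOn u (Ioo 0 l) := by
    intro u
    have : IsFiniteMeasure (volume.restrict (Ioo (0 : ℝ) l)) := by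
      infer_instance
    have hu : IntegrableOn u (Ioo 0 l) := (Lp.memLp u).integrable (by norm_num)
    exact hu.locallyIntegrableOn
  have key : ∀ᵐ x ∂volume, x ∈ Ioo 0 l → (g x - h x) = 0 := by
    apply isOpen_Ioo.ae_eq_zero_of_integral_contDiff_smul_eq_zero
      ((hloc g).sub (hloc h))
    intro φ hφ hc hs
    have hT : IsTest l (fun x => (φ x : ℂ)) := by
      have hsub : tsupport (fun x => (φ x : ℂ)) ⊆ tsupport φ :=
        closure_mono (fun x hx => by simpa using hx)
      exact ⟨Complex.ofRealCLM.contDiff.comp hφ, hc.comp_left (g := fun t : ℝ => (t : ℂ)) (by simp),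
        hsub.trans hs⟩
    have e := (hg _ hT).symm.trans (hh _ hT)
    have e' := neg_injective e
    have hzero : ∀ x, x ∉ Ioo 0 l → φ x • (g x - h x) = 0 := by
      intro x hx
      rw [image_eq_zero_of_notMem_tsupport (fun hx' => hx (hs hx')), zero_smul]
    change ∫ x, φ x • (g x - h x) = 0
    rw [← setIntegral_eq_integral_of_forall_compl_eq_zero hzero]
    have : ∫ x in Ioo 0 l, φ x • (g x - h x)
        = ∫ x in Ioo 0 l, (g x * (φ x : ℂ) - h x * (φ x : ℂ)) := by
      apply integral_congr_ae
      filter_upwards with x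
      rw [Complex.real_smul]
      ring
    rw [this, integral_sub (integrable_mul_test g hT) (integrable_mul_test h hT), e', sub_self]
  apply Lp.ext
  filter_upwards [(ae_restrict_iff' measurableSet_Ioo).2 key] with x hx
  exact sub_eq_zero.1 hx

/-- Triples `(f, f', f'')` with weak derivatives in `L²(0, l)`; with the norm of the product this
is the space `W^{2,2}(0, l)` with its norm, up to equivalence. -/
def sobolevJet (l : ℝ) : Submodule ℂ (EdgeL2 l × EdgeL2 l × EdgeL2 l) where
  carrier := {p | HasWeakDeriv l p.1 p.2.1 ∧ HasWeakDeriv l p.2.1 p.2.2}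
  zero_mem' := ⟨HasWeakDeriv.zero l, HasWeakDeriv.zero l⟩
  add_mem' := fun hp hq => ⟨hp.1.add hq.1, hp.2.add hq.2⟩
  smul_mem' := fun c _ hp => ⟨hp.1.const_smul c, hp.2.const_smul c⟩

/-- Triples `(φ, φ', φ'')` with `φ ∈ C_c^∞(0, l)`. -/
def testJet (l : ℝ) : Submodule ℂ (EdgeL2 l × EdgeL2 l × EdgeL2 l) where
  carrier := {p | ∃ φ : ℝ → ℂ, IsTest l φ ∧ p.1 =ᵐ[volume.restrict (Ioo 0 l)] φ ∧
    p.2.1 =ᵐ[volume.restrict (Ioo 0 l)] deriv φ ∧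
    p.2.2 =ᵐ[volume.restrict (Ioo 0 l)] deriv (deriv φ)}
  zero_mem' := by
    have h := Lp.coeFn_zero ℂ 2 (volume.restrict (Ioo 0 l))
    have hd : deriv (0 : ℝ → ℂ) = 0 := by funext x; simp
    refine ⟨0, IsTest.zero l, h, ?_, ?_⟩
    · rw [hd]; exact h
    · rw [hd, hd]; exact h
  add_mem' := by
    rintro p q ⟨φ, hφ, h1, h2, h3⟩ ⟨ψ, hψ, k1, k2, k3⟩
    have hd : ∀ {a b : ℝ → ℂ}, IsTest l a → IsTest l b →
        deriv (a + b) = deriv a + deriv b := by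
      intro a b ha hb
      funext x
      exact deriv_add (ha.smooth.differentiable (by simp) x) (hb.smooth.differentiable (by simp) x)
    refine ⟨φ + ψ, hφ.add hψ, (Lp.coeFn_add _ _).trans (h1.add k1), ?_, ?_⟩
    · rw [hd hφ hψ]; exact (Lp.coeFn_add _ _).trans (h2.add k2)
    · rw [hd hφ hψ, hd hφ.deriv hψ.deriv]; exact (Lp.coeFn_add _ _).trans (h3.add k3)
  smul_mem' := by
    rintro c p ⟨φ, hφ, h1, h2, h3⟩
    have hd : ∀ a : ℝ → ℂ, deriv (c • a) = c • deriv a := by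
      intro a
      funext x
      exact deriv_const_smul_field c a
    refine ⟨c • φ, hφ.const_smul c, (Lp.coeFn_smul _ _).trans (h1.const_smul c), ?_, ?_⟩
    · rw [hd]; exact (Lp.coeFn_smul _ _).trans (h2.const_smul c)
    · rw [hd, hd]; exact (Lp.coeFn_smul _ _).trans (h3.const_smul c)

/-- The Sobolev space `W^{2,2}(0, l)`, as a subspace of `L²(0, l)`. -/
def W22 (l : ℝ) : Submodule ℂ (EdgeL2 l) :=
  (sobolevJet l).map (LinearMap.fst ℂ (EdgeL2 l) (EdgeL2 l × EdgeL2 l))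

/-- The Sobolev space `W^{2,2}_0(0, l)`: the closure of `C_c^∞(0, l)` in `W^{2,2}(0, l)`. -/
def W22zero (l : ℝ) : Submodule ℂ (EdgeL2 l) :=
  (sobolevJet l ⊓ (testJet l).topologicalClosure).map
    (LinearMap.fst ℂ (EdgeL2 l) (EdgeL2 l × EdgeL2 l))

theorem exists_secondWeakDeriv {l : ℝ} (f : W22 l) :
    ∃ h : EdgeL2 l, ∃ g : EdgeL2 l, HasWeakDeriv l f g ∧ HasWeakDeriv l g h := by
  obtain ⟨p, hp, hpf⟩ := f.2
  refine ⟨p.2.2, p.2.1, ?_, hp.2⟩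
  rw [← hpf]
  exact hp.1

/-- The second weak derivative on `W^{2,2}(0, l)`. -/
def secondWeakDeriv (l : ℝ) : W22 l →ₗ[ℂ] EdgeL2 l where
  toFun f := (exists_secondWeakDeriv f).choose
  map_add' := by
    intro f g
    obtain ⟨a, ha, ha'⟩ := (exists_secondWeakDeriv f).choose_spec
    obtain ⟨b, hb, hb'⟩ := (exists_secondWeakDeriv g).choose_spec
    obtain ⟨c, hc, hc'⟩ := (exists_secondWeakDeriv (f + g)).choose_spec
    have h : c = a + b := hc.unique (ha.add hb)
    subst h
    exact hc'.unique (ha'.add hb')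
  map_smul' := by
    intro r f
    obtain ⟨a, ha, ha'⟩ := (exists_secondWeakDeriv f).choose_spec
    obtain ⟨c, hc, hc'⟩ := (exists_secondWeakDeriv (r • f)).choose_spec
    have h : c = r • a := hc.unique (ha.const_smul r)
    subst h
    exact hc'.unique (ha'.const_smul r)

/-- The maximal operator `-d²/dx²` in `L²(0, l)`, with domain `W^{2,2}(0, l)`. -/
def edgeMax (l : ℝ) : EdgeL2 l →ₗ.[ℂ] EdgeL2 l where
  domain := W22 l
  toFun := -secondWeakDeriv l

/-- The minimal operator `-d²/dx²` in `L²(0, l)`, with domain `W^{2,2}_0(0, l)`. -/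
def edgeMin (l : ℝ) : EdgeL2 l →ₗ.[ℂ] EdgeL2 l where
  domain := W22zero l
  toFun := -(secondWeakDeriv l ∘ₗ Submodule.inclusion (Submodule.map_mono inf_le_left))

/-- `u = (f(0), f(l))` are the boundary values and `u' = (f'(0), f'(l))` the boundary derivatives,
taken in the inward direction, of the continuous representative `F` of `f` on `(0, l)`. -/
def HasTraces (l : ℝ) (f : EdgeL2 l) (u u' : Fin 2 → ℂ) : Prop :=
  ∃ F : ℝ → ℂ, ContinuousOn F (Ioo 0 l) ∧ f =ᵐ[volume.restrict (Ioo 0 l)] F ∧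
    Tendsto F (𝓝[>] 0) (𝓝 (u 0)) ∧
    Tendsto F (𝓝[<] l) (𝓝 (u 1)) ∧
    Tendsto (fun x : ℝ => (F x - u 0) / ((|x - 0| : ℝ) : ℂ)) (𝓝[>] 0) (𝓝 (u' 0)) ∧
    Tendsto (fun x : ℝ => (F x - u 1) / ((|x - l| : ℝ) : ℂ)) (𝓝[<] l) (𝓝 (u' 1))

/-! ### Metric graphs -/

/-- A directed metric graph with vertices `V` and edges `E`: each edge has an initial vertex, a
terminal vertex, and a finite positive length; it is identified with the interval `(0, |e|)`, where
`0` corresponds to the initial vertex. -/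
structure MetricGraph (V E : Type*) where
  init : E → V
  term : E → V
  length : E → ℝ
  length_pos : ∀ e, 0 < length e

namespace MetricGraph

variable {V E : Type*} (G : MetricGraph V E)

/-- The Hilbert space `L²(𝒢) = ⨁ₑ L²(e)`. -/
abbrev L2 : Type _ := lp (fun e => EdgeL2 (G.length e)) 2

/-- The Hilbert space `⨁ₑ ℂ²`. -/
abbrev BoundarySpace (_G : MetricGraph V E) : Type _ :=
  lp (fun _ : E => EuclideanSpace ℂ (Fin 2)) 2

/-- The maximal operator on the graph. -/
def Hmax : G.L2 →ₗ.[ℂ] G.L2 := directSum fun e => edgeMax (G.length e)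

/-- The minimal operator on the graph. -/
def Hmin : G.L2 →ₗ.[ℂ] G.L2 := directSum fun e => edgeMin (G.length e)

/-- `R_e = √|e| I₂`. -/
def R (e : E) : Matrix (Fin 2) (Fin 2) ℂ := ((√(G.length e) : ℝ) : ℂ) • 1

/-- `Q_e = |e|⁻¹ (-1, 1; 1, -1)`. -/
def Q (e : E) : Matrix (Fin 2) (Fin 2) ℂ := (1 / (G.length e : ℂ)) • !![-1, 1; 1, -1]

/-- `M⁰_e(z) = √z (-cot (|e|√z), csc (|e|√z); csc (|e|√z), -cot (|e|√z))`, with the principal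
branch of the square root. -/
def weylZero (e : E) (z : ℂ) : Matrix (Fin 2) (Fin 2) ℂ :=
  let s : ℂ := z ^ (1 / 2 : ℂ)
  let w : ℂ := (G.length e : ℂ) * s
  s • !![-Complex.cot w, 1 / Complex.sin w; 1 / Complex.sin w, -Complex.cot w]

/-- `M_e(z) = R_e⁻¹ (M⁰_e(z) - Q_e) R_e⁻¹`. -/
def weylReg (e : E) (z : ℂ) : Matrix (Fin 2) (Fin 2) ℂ :=
  (G.R e)⁻¹ * (G.weylZero e z - G.Q e) * (G.R e)⁻¹

end MetricGraph

end

end QuantumGraph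

open QuantumGraph

namespace QuantumGraph

noncomputable section

/-! ### Integration by parts for primitives of integrable functions -/

/-! A direct sum of boundary triplets can fail to be one only through lack of uniformity: Green's
identity, closedness, density and the adjoint relation all pass to Hilbert sums componentwise, but
the boundary maps must be bounded in the graph norms with a common constant and must have right
inverses with a common bound (`IsPreTriplet.directSum`). The matrices `R_e` and `Q_e` are chosen to
give this when the lengths are bounded above by `L`.

On an edge of length `l`, the Lagrange identity turns `∫ (f'' P - f P'')` into a combination of
boundary values of `f` and `f'`, so suitable cubics `P` express the boundary maps as explicit
bounded functionals. For the values `√l f(0)`, `√l f(l)` the bound is `6 l² ‖f''‖ + 18 ‖f‖`.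
Subtracting `Q_e` replaces the boundary derivatives of `f` by those of `f` minus its affine
interpolant; then `P` is affine, only `‖f''‖` enters, and its factor `√l` is cancelled by `R_e⁻¹`.
Conversely, cubic Hermite interpolation gives a preimage of any boundary data with norm controlled
by `L` alone (`exists_edgeΓ_eq`).

The edge theory rests on the du Bois-Reymond lemma: elements of `W22` are represented by C¹
functions whose derivative is a primitive, and an L² function whose distributional second derivative
is in L² lies in `W22`. The latter identifies the adjoint of the minimal operator
(`edgeMin_adjoint`).

The remaining assertions follow from Green's identity abstractly. The restriction `A₀` to `ker Γ₀`
is selfadjoint, so nonreal `z` lie in its resolvent set, its Cayley transform identifies the two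
defect spaces, and the open mapping theorem makes the Weyl function bounded. Its formula is computed
on each edge by pairing a solution of `-f'' = z f` with two sine functions, each vanishing at one
endpoint. -/

theorem setIntegral_Ioo_eq_intervalIntegral {l : ℝ} (hl : 0 ≤ l) (f : ℝ → ℂ) :
    ∫ x in Ioo 0 l, f x = ∫ x in (0 : ℝ)..l, f x := by
  rw [intervalIntegral.integral_of_le hl, integral_Ioc_eq_integral_Ioo]

/-- Fubini on the triangle `t < x`. Since `h` is merely integrable, its primitive need not be
differentiable everywhere, so the product rule is avoided. -/
theorem integral_primitive_mul_deriv {l : ℝ} {h K K' : ℝ → ℂ}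
    (hh : IntegrableOn h (Ioo 0 l)) (hK : ∀ x, HasDerivAt K (K' x) x) (hK' : Continuous K') :
    ∫ x in Ioo 0 l, (∫ t in (0 : ℝ)..x, h t) * K' x = ∫ t in Ioo 0 l, h t * (K l - K t) := by
  have hKi : IntegrableOn K' (Ioo 0 l) :=
    (hK'.integrableOn_Icc).mono_set Ioo_subset_Icc_self
  have hS : MeasurableSet {p : ℝ × ℝ | p.2 < p.1} := measurableSet_lt measurable_snd measurable_fst
  have hint : Integrable
      (Function.uncurry fun x t : ℝ => (Iio x).indicator (fun t => h t * K' x) t)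
      ((volume.restrict (Ioo 0 l)).prod (volume.restrict (Ioo 0 l))) := by
    have h1 : Integrable (fun p : ℝ × ℝ => K' p.1 * h p.2)
        ((volume.restrict (Ioo 0 l)).prod (volume.restrict (Ioo 0 l))) := hKi.mul_prod hh
    refine (h1.indicator hS).congr (ae_of_all _ fun p => ?_)
    by_cases hp : p.2 < p.1 <;> simp [Function.uncurry, Set.indicator, hp, mul_comm]
  have hswap := integral_integral_swap hint
  have e1 : ∫ x in Ioo 0 l, (∫ t in (0 : ℝ)..x, h t) * K' x
      = ∫ x in Ioo 0 l, ∫ t in Ioo 0 l, (Iio x).indicator (fun t => h t * K' x) t := by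
    refine setIntegral_congr_fun measurableSet_Ioo fun x hx => ?_
    have : Ioo 0 l ∩ Iio x = Ioo 0 x := by
      ext t; simp only [mem_inter_iff, mem_Ioo, mem_Iio]
      exact ⟨fun h => ⟨h.1.1, h.2⟩, fun h => ⟨⟨h.1, h.2.trans hx.2⟩, h.2⟩⟩
    rw [setIntegral_indicator measurableSet_Iio, this, integral_mul_const,
      setIntegral_Ioo_eq_intervalIntegral hx.1.le]
  have e2 : ∫ t in Ioo 0 l, h t * (K l - K t)
      = ∫ t in Ioo 0 l, ∫ x in Ioo 0 l, (Iio x).indicator (fun t => h t * K' x) t := by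
    refine setIntegral_congr_fun measurableSet_Ioo fun t ht => ?_
    have e3 : ∀ x, (Iio x).indicator (fun t => h t * K' x) t
        = (Ioi t).indicator (fun x => h t * K' x) x := by
      intro x
      by_cases hx : t < x <;> simp [Set.indicator, hx]
    have : Ioo 0 l ∩ Ioi t = Ioo t l := by
      ext x; simp only [mem_inter_iff, mem_Ioo, mem_Ioi]
      exact ⟨fun h => ⟨h.2, h.1.2⟩, fun h => ⟨⟨ht.1.trans h.1, h.2⟩, h.1⟩⟩
    simp only [e3]
    rw [setIntegral_indicator measurableSet_Ioi, this, integral_const_mul,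
      ← integral_Ioc_eq_integral_Ioo, ← intervalIntegral.integral_of_le ht.2.le,
      intervalIntegral.integral_eq_sub_of_hasDerivAt (fun x _ => hK x)
        (hK'.intervalIntegrable _ _)]
  rw [e1, e2, hswap]

/-- Integration by parts on `(0, l)`, where `H` is a primitive of the integrable function `h`. -/
theorem integral_mul_deriv_of_primitive {l : ℝ} (hl : 0 < l) {H h K K' : ℝ → ℂ}
    (hh : IntegrableOn h (Ioo 0 l)) (hH : ∀ x ∈ Icc 0 l, H x = H 0 + ∫ t in (0 : ℝ)..x, h t)
    (hK : ∀ x, HasDerivAt K (K' x) x) (hK' : Continuous K') :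
    ∫ x in Ioo 0 l, H x * K' x = H l * K l - H 0 * K 0 - ∫ x in Ioo 0 l, h x * K x := by
  have hKc : Continuous K := continuous_iff_continuousAt.2 fun x => (hK x).continuousAt
  have hKi : IntegrableOn K' (Ioo 0 l) :=
    (hK'.integrableOn_Icc).mono_set Ioo_subset_Icc_self
  have hhK : IntegrableOn (fun x => h x * K x) (Ioo 0 l) := by
    have h1 : IntegrableOn h (Icc 0 l) :=
      (integrableOn_Icc_iff_integrableOn_Ioo (by simp) (by simp)).2 hh
    exact (h1.mul_continuousOn hKc.continuousOn isCompact_Icc).mono_set Ioo_subset_Icc_self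
  have hprim : IntegrableOn (fun x => (∫ t in (0 : ℝ)..x, h t) * K' x) (Ioo 0 l) := by
    have h1 : IntegrableOn h (Icc 0 l) :=
      (integrableOn_Icc_iff_integrableOn_Ioo (by simp) (by simp)).2 hh
    have h2 : ContinuousOn (fun x => ∫ t in (0 : ℝ)..x, h t) (Icc 0 l) :=
      intervalIntegral.continuousOn_primitive_interval (by rwa [uIcc_of_le hl.le]) |>.mono
        (by rw [uIcc_of_le hl.le])
    exact ((h2.mul hK'.continuousOn).integrableOn_Icc).mono_set Ioo_subset_Icc_self
  have e1 : ∫ x in Ioo 0 l, H x * K' x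
      = ∫ x in Ioo 0 l, (H 0 * K' x + (∫ t in (0 : ℝ)..x, h t) * K' x) := by
    refine setIntegral_congr_fun measurableSet_Ioo fun x hx => ?_
    rw [hH x (Ioo_subset_Icc_self hx), add_mul]
  have e2 : ∫ x in Ioo 0 l, K' x = K l - K 0 := by
    rw [setIntegral_Ioo_eq_intervalIntegral hl.le,
      intervalIntegral.integral_eq_sub_of_hasDerivAt (fun x _ => hK x)
        (hK'.intervalIntegrable _ _)]
  have e3 : ∫ x in Ioo 0 l, h x * (K l - K x)
      = (∫ x in Ioo 0 l, h x) * K l - ∫ x in Ioo 0 l, h x * K x := by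
    simp_rw [mul_sub]
    rw [integral_sub (hh.mul_const _) hhK, integral_mul_const]
  have e4 : ∫ x in Ioo 0 l, h x = H l - H 0 := by
    rw [setIntegral_Ioo_eq_intervalIntegral hl.le, hH l (right_mem_Icc.2 hl.le)]
    ring
  rw [e1, integral_add (hKi.const_mul _) hprim, integral_const_mul, e2,
    integral_primitive_mul_deriv hh hK hK', e3, e4]
  ring

/-! ### Continuous functions as elements of `L²(0, l)` -/

theorem memLp_of_continuous (l : ℝ) {F : ℝ → ℂ} (hF : Continuous F) :
    MemLp F 2 (volume.restrict (Ioo 0 l)) := by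
  obtain ⟨C, hC⟩ := (isCompact_Icc (a := 0) (b := l)).exists_bound_of_continuousOn hF.continuousOn
  refine MemLp.of_bound hF.aestronglyMeasurable C ?_
  filter_upwards [ae_restrict_mem measurableSet_Ioo] with x hx
  exact hC x (Ioo_subset_Icc_self hx)

/-- The class in `L²(0, l)` of a continuous function. -/
def ofContinuous (l : ℝ) {F : ℝ → ℂ} (hF : Continuous F) : EdgeL2 l :=
  (memLp_of_continuous l hF).toLp F

theorem coeFn_ofContinuous (l : ℝ) {F : ℝ → ℂ} (hF : Continuous F) :
    ofContinuous l hF =ᵐ[volume.restrict (Ioo 0 l)] F :=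
  MemLp.coeFn_toLp _

theorem integral_mul_congr {l : ℝ} {f F : ℝ → ℂ} (h : f =ᵐ[volume.restrict (Ioo 0 l)] F)
    (G : ℝ → ℂ) : ∫ x in Ioo 0 l, f x * G x = ∫ x in Ioo 0 l, F x * G x :=
  integral_congr_ae (h.mono fun x hx => by simp only [hx])

theorem norm_ofContinuous_le {l C : ℝ} (hl : 0 ≤ l) {F : ℝ → ℂ} (hF : Continuous F)
    (hC : 0 ≤ C) (h : ∀ x ∈ Ioo 0 l, ‖F x‖ ≤ C) : ‖ofContinuous l hF‖ ≤ √l * C := by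
  have := Lp.norm_le_of_ae_bound (f := ofContinuous l hF) hC (by
    filter_upwards [coeFn_ofContinuous l hF, ae_restrict_mem measurableSet_Ioo] with x hx hx'
    rw [hx]
    exact h x hx')
  refine this.trans (le_of_eq ?_)
  congr 1
  have h2 : ((ENNReal.ofReal l).toNNReal : ℝ) = l := ENNReal.toReal_ofReal hl
  simp [Real.sqrt_eq_rpow, measureUnivNNReal, h2]

theorem integrableOn_edgeL2 {l : ℝ} (h : EdgeL2 l) : IntegrableOn h (Ioo 0 l) := by
  have : IsFiniteMeasure (volume.restrict (Ioo (0 : ℝ) l)) := inferInstance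
  exact (Lp.memLp h).integrable (by norm_num)

/-! ### Weak derivatives of primitives -/

theorem IsTest.eq_zero {l : ℝ} {φ : ℝ → ℂ} (hφ : IsTest l φ) {x : ℝ} (hx : x ∉ Ioo 0 l) :
    φ x = 0 :=
  image_eq_zero_of_notMem_tsupport fun h => hx (hφ.support h)

theorem IsTest.hasDerivAt {l : ℝ} {φ : ℝ → ℂ} (hφ : IsTest l φ) (x : ℝ) :
    HasDerivAt φ (_root_.deriv φ x) x :=
  (hφ.smooth.differentiable (by simp) x).hasDerivAt

theorem hasWeakDeriv_of_primitive {l : ℝ} (hl : 0 < l) {f g : EdgeL2 l} {F h : ℝ → ℂ}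
    (hf : f =ᵐ[volume.restrict (Ioo 0 l)] F) (hg : g =ᵐ[volume.restrict (Ioo 0 l)] h)
    (hF : ∀ x ∈ Icc 0 l, F x = F 0 + ∫ t in (0 : ℝ)..x, h t) : HasWeakDeriv l f g := by
  intro φ hφ
  have hh : IntegrableOn h (Ioo 0 l) := (integrableOn_edgeL2 g).congr_fun_ae hg
  rw [integral_mul_congr hf, integral_mul_congr hg,
    integral_mul_deriv_of_primitive hl hh hF hφ.hasDerivAt hφ.deriv.smooth.continuous,
    hφ.eq_zero (x := 0) (by simp), hφ.eq_zero (x := l) (by simp)]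
  ring

theorem eq_add_integral_of_hasDerivAt {F F' : ℝ → ℂ} (hF : ∀ x, HasDerivAt F (F' x) x)
    (hF' : Continuous F') (x : ℝ) : F x = F 0 + ∫ t in (0 : ℝ)..x, F' t := by
  rw [intervalIntegral.integral_eq_sub_of_hasDerivAt (fun x _ => hF x)
        (hF'.intervalIntegrable _ _)]
  ring

theorem hasWeakDeriv_ofContinuous {l : ℝ} (hl : 0 < l) {F F' : ℝ → ℂ} (hFc : Continuous F)
    (hF : ∀ x, HasDerivAt F (F' x) x) (hF' : Continuous F') :
    HasWeakDeriv l (ofContinuous l hFc) (ofContinuous l hF') :=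
  hasWeakDeriv_of_primitive hl (coeFn_ofContinuous l hFc) (coeFn_ofContinuous l hF')
    fun x _ => eq_add_integral_of_hasDerivAt hF hF' x

/-- Integrating the extension of `h` by zero makes the primitive continuous on all of `ℝ`, so no
one-sided conditions at the endpoints are needed. -/
theorem exists_primitive {l : ℝ} (h : EdgeL2 l) :
    ∃ H : ℝ → ℂ, Continuous H ∧ H 0 = 0 ∧
      ∀ x ∈ Icc 0 l, H x = H 0 + ∫ t in (0 : ℝ)..x, h t := by
  have hi : Integrable ((Ioo 0 l).indicator h) :=
    (integrable_indicator_iff measurableSet_Ioo).2 (integrableOn_edgeL2 h)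
  refine ⟨fun x => ∫ t in (0 : ℝ)..x, (Ioo 0 l).indicator h t,
    intervalIntegral.continuous_primitive (fun _ _ => hi.intervalIntegrable) 0, by simp,
    fun x hx => ?_⟩
  simp only [intervalIntegral.integral_same, zero_add]
  rw [intervalIntegral.integral_of_le hx.1, intervalIntegral.integral_of_le hx.1,
    integral_Ioc_eq_integral_Ioo, integral_Ioc_eq_integral_Ioo]
  refine setIntegral_congr_fun measurableSet_Ioo fun t ht => ?_
  have ht' : t ∈ Ioo 0 l := ⟨ht.1, ht.2.trans_le hx.2⟩
  simp only [indicator_of_mem ht']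

/-! ### The du Bois-Reymond lemma -/

theorem exists_isTest_integral_eq_one {l : ℝ} (hl : 0 < l) :
    ∃ η : ℝ → ℂ, IsTest l η ∧ ∫ x in Ioo 0 l, η x = 1 := by
  let b : ContDiffBump (l / 2) := ⟨l / 8, l / 4, by positivity, by linarith⟩
  have hsupp : tsupport (fun x => ((b.normed volume x : ℝ) : ℂ)) ⊆ Ioo 0 l := by
    have h1 : tsupport (fun x => ((b.normed volume x : ℝ) : ℂ)) ⊆ tsupport (b.normed volume) :=
      closure_mono fun x hx => by simpa using hx
    refine h1.trans ?_
    rw [b.tsupport_normed_eq, Real.closedBall_eq_Icc]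
    change Icc (l / 2 - l / 4) (l / 2 + l / 4) ⊆ _
    intro x hx
    constructor <;> linarith [hx.1, hx.2]
  have hT : IsTest l (fun x => ((b.normed volume x : ℝ) : ℂ)) :=
    ⟨Complex.ofRealCLM.contDiff.comp b.contDiff_normed,
      b.hasCompactSupport_normed.comp_left (g := fun t : ℝ => (t : ℂ)) (by simp), hsupp⟩
  refine ⟨_, hT, ?_⟩
  rw [setIntegral_eq_integral_of_forall_compl_eq_zero fun x hx => hT.eq_zero hx,
    integral_complex_ofReal, b.integral_normed, Complex.ofReal_one]

/-- The primitive from `0` vanishes to the left of the support of `ψ`, and to the right of it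
because the total integral is zero. -/
theorem IsTest.exists_primitive {l : ℝ} (hl : 0 < l) {ψ : ℝ → ℂ} (hψ : IsTest l ψ)
    (h0 : ∫ x in Ioo 0 l, ψ x = 0) : ∃ φ, IsTest l φ ∧ _root_.deriv φ = ψ := by
  have hc := hψ.smooth.continuous
  have hd : ∀ x, HasDerivAt (fun x => ∫ t in (0 : ℝ)..x, ψ t) (ψ x) x := fun x =>
    intervalIntegral.integral_hasDerivAt_right (hc.intervalIntegrable _ _)
      (hc.stronglyMeasurableAtFilter _ _) hc.continuousAt
  have hd' : _root_.deriv (fun x => ∫ t in (0 : ℝ)..x, ψ t) = ψ := funext fun x => (hd x).deriv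
  obtain ⟨a, b, ha, hb, hab⟩ : ∃ a b, 0 < a ∧ b < l ∧ tsupport ψ ⊆ Icc a b := by
    rcases (tsupport ψ).eq_empty_or_nonempty with he | hne
    · exact ⟨l / 2, l / 2, by positivity, by linarith, by simp [he]⟩
    · have hK : IsCompact (tsupport ψ) := hψ.compact
      exact ⟨sInf (tsupport ψ), sSup (tsupport ψ), (hψ.support (hK.sInf_mem hne)).1,
        (hψ.support (hK.sSup_mem hne)).2, fun x hx => ⟨csInf_le hK.bddBelow hx,
          le_csSup hK.bddAbove hx⟩⟩
  have hz : ∀ x, x ∉ Icc a b → ψ x = 0 := fun x hx =>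
    image_eq_zero_of_notMem_tsupport fun h => hx (hab h)
  have hs : Function.support (fun x => ∫ t in (0 : ℝ)..x, ψ t) ⊆ Icc a b := by
    intro x hx
    by_contra hx'
    apply hx
    simp only [mem_Icc, not_and_or, not_le] at hx'
    rcases hx' with h | h
    · refine intervalIntegral.integral_zero_ae (ae_of_all _ fun t ht => hz t fun h' => ?_)
      have : t ≤ max 0 x := ht.2
      have : max 0 x < a := max_lt ha h
      linarith [h'.1]
    · change (∫ t in (0 : ℝ)..x, ψ t) = 0
      have e1 : (∫ t in (0 : ℝ)..l, ψ t) = 0 := by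
        rw [← setIntegral_Ioo_eq_intervalIntegral hl.le, h0]
      have e2 : (∫ t in l..x, ψ t) = 0 := by
        refine intervalIntegral.integral_zero_ae (ae_of_all _ fun t ht => hz t fun h' => ?_)
        have : min l x < t := ht.1
        have : b < min l x := lt_min hb h
        linarith [h'.2]
      rw [← intervalIntegral.integral_add_adjacent_intervals
        (hc.intervalIntegrable 0 l) (hc.intervalIntegrable l x), e1, e2, add_zero]
  refine ⟨_, ⟨?_, HasCompactSupport.intro (isCompact_Icc (a := a) (b := b)) fun x hx => ?_, ?_⟩, hd'⟩
  · rw [contDiff_infty_iff_deriv, hd']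
    exact ⟨fun x => (hd x).differentiableAt, hψ.smooth⟩
  · by_contra h
    exact hx (hs h)
  · exact (closure_minimal hs isClosed_Icc).trans fun x hx =>
      ⟨ha.trans_le hx.1, hx.2.trans_lt hb⟩

/-- A linear functional which vanishes on the derivatives of test functions is a multiple of the
integral. -/
theorem exists_forall_integral_eq {l : ℝ} (hl : 0 < l) (L : (ℝ → ℂ) → ℂ)
    (hL : ∀ φ ψ c, IsTest l φ → IsTest l ψ → L (φ + c • ψ) = L φ + c * L ψ)
    (h : ∀ φ, IsTest l φ → L (deriv φ) = 0) :
    ∃ c, ∀ ψ, IsTest l ψ → L ψ = c * ∫ x in Ioo 0 l, ψ x := by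
  obtain ⟨η, hη, hη1⟩ := exists_isTest_integral_eq_one hl
  refine ⟨L η, fun ψ hψ => ?_⟩
  have hi : ∀ {φ : ℝ → ℂ}, IsTest l φ → IntegrableOn φ (Ioo 0 l) := fun hφ =>
    (hφ.smooth.continuous.integrableOn_Icc).mono_set Ioo_subset_Icc_self
  set c := ∫ x in Ioo 0 l, ψ x with hc
  -- Subtracting `c η` makes the mean zero, so the difference is the derivative of a test function
  -- and `L` kills it.
  have hT : IsTest l (ψ + (-c) • η) := hψ.add (hη.const_smul _)
  obtain ⟨φ, hφ, hφ'⟩ := hT.exists_primitive hl (by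
    simp only [Pi.add_apply, Pi.smul_apply, smul_eq_mul]
    rw [integral_add (hi hψ) ((hi hη).const_mul _), integral_const_mul, hη1, ← hc]
    ring)
  have := h φ hφ
  rw [hφ', hL ψ η _ hψ hη] at this
  linear_combination this

theorem hasWeakDeriv_ofContinuous_const {l : ℝ} (c : ℂ) :
    HasWeakDeriv l (ofContinuous l (continuous_const (y := c))) 0 := by
  intro φ hφ
  rw [integral_mul_congr (Lp.coeFn_zero ..), integral_mul_congr (coeFn_ofContinuous ..)]
  simp only [Pi.zero_apply, zero_mul, integral_zero, neg_zero]
  rw [integral_const_mul]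
  rcases le_or_gt l 0 with hl | hl
  · simp [Ioo_eq_empty_of_le hl]
  rw [setIntegral_Ioo_eq_intervalIntegral hl.le,
    intervalIntegral.integral_eq_sub_of_hasDerivAt (fun x _ => hφ.hasDerivAt x)
      (hφ.deriv.smooth.continuous.intervalIntegrable _ _), hφ.eq_zero (x := l) (by simp),
      hφ.eq_zero (x := 0) (by simp)]
  ring

theorem eq_const_of_hasWeakDeriv_zero {l : ℝ} (hl : 0 < l) {f : EdgeL2 l}
    (hf : HasWeakDeriv l f 0) :
    ∃ c : ℂ, f = ofContinuous l (continuous_const (y := c)) := by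
  obtain ⟨c, hc⟩ := exists_forall_integral_eq hl (fun φ => ∫ x in Ioo 0 l, f x * φ x)
    (fun φ ψ c hφ hψ => by
      simp only [Pi.add_apply, Pi.smul_apply, smul_eq_mul, mul_add, mul_left_comm _ c]
      rw [integral_add (integrable_mul_test f hφ) ((integrable_mul_test f hψ).const_mul c),
        integral_const_mul])
    (fun φ hφ => by
      rw [hf φ hφ, integral_mul_congr (Lp.coeFn_zero ..)]
      simp)
  refine ⟨c, ?_⟩
  -- `f - c` integrates to zero against every test function, that is, it is a weak derivative of
  -- `0`; uniqueness then gives `f = c`.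
  have h0 : HasWeakDeriv l 0 (f - ofContinuous l (continuous_const (y := c))) := by
    intro φ hφ
    rw [integral_mul_congr (Lp.coeFn_zero ..), integral_mul_congr (Lp.coeFn_sub ..)]
    simp only [Pi.zero_apply, zero_mul, integral_zero, Pi.sub_apply, sub_mul]
    rw [integral_sub (integrable_mul_test f hφ) (integrable_mul_test _ hφ), hc φ hφ,
      integral_mul_congr (coeFn_ofContinuous ..), integral_const_mul]
    simp
  exact sub_eq_zero.1 (h0.unique (HasWeakDeriv.zero l))

/-! ### Jets: the functions of `W^{2,2}(0, l)` -/

/-- `F` is continuously differentiable with derivative `F'`, which on `[0, l]` is a primitive of the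
integrable function `h`. -/
structure IsJet (l : ℝ) (F F' h : ℝ → ℂ) : Prop where
  hasDerivAt : ∀ x, HasDerivAt F (F' x) x
  continuous_deriv : Continuous F'
  integrableOn : IntegrableOn h (Ioo 0 l)
  primitive : ∀ x ∈ Icc 0 l, F' x = F' 0 + ∫ t in (0 : ℝ)..x, h t

theorem IsJet.continuous {l : ℝ} {F F' h : ℝ → ℂ} (hF : IsJet l F F' h) : Continuous F :=
  continuous_iff_continuousAt.2 fun x => (hF.hasDerivAt x).continuousAt

theorem IsJet.of_hasDerivAt (l : ℝ) {F F' F'' : ℝ → ℂ} (hF : ∀ x, HasDerivAt F (F' x) x)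
    (hF' : ∀ x, HasDerivAt F' (F'' x) x) (hc : Continuous F'') : IsJet l F F' F'' :=
  ⟨hF, continuous_iff_continuousAt.2 fun x => (hF' x).continuousAt,
    hc.integrableOn_Icc.mono_set Ioo_subset_Icc_self,
    fun x _ => eq_add_integral_of_hasDerivAt hF' hc x⟩

theorem intervalIntegral_congr_edge {l : ℝ} {h k : ℝ → ℂ}
    (hk : h =ᵐ[volume.restrict (Ioo 0 l)] k) {x : ℝ} (hx : x ∈ Icc 0 l) :
    ∫ t in (0 : ℝ)..x, h t = ∫ t in (0 : ℝ)..x, k t := by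
  rw [← setIntegral_Ioo_eq_intervalIntegral hx.1, ← setIntegral_Ioo_eq_intervalIntegral hx.1]
  exact integral_congr_ae (ae_restrict_of_ae_restrict_of_subset (Ioo_subset_Ioo_right hx.2) hk)

theorem IsJet.congr {l : ℝ} {F F' h k : ℝ → ℂ} (hF : IsJet l F F' h)
    (hk : h =ᵐ[volume.restrict (Ioo 0 l)] k) : IsJet l F F' k :=
  ⟨hF.hasDerivAt, hF.continuous_deriv, hF.integrableOn.congr_fun_ae hk, fun x hx => by
    rw [hF.primitive x hx, intervalIntegral_congr_edge hk hx]⟩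

theorem IsJet.conj {l : ℝ} {F F' h : ℝ → ℂ} (hF : IsJet l F F' h) :
    IsJet l (fun x => star (F x)) (fun x => star (F' x)) (fun x => star (h x)) := by
  refine ⟨fun x => (hF.hasDerivAt x).star, hF.continuous_deriv.star, ?_, fun x hx => ?_⟩
  · exact Complex.conjCLE.toContinuousLinearMap.integrable_comp hF.integrableOn
  · rw [hF.primitive x hx, star_add]
    congr 1
    exact (Complex.conjCLE.toContinuousLinearMap.intervalIntegral_comp_comm
      ((intervalIntegrable_iff_integrableOn_Ioo_of_le hx.1).2
        (hF.integrableOn.mono_set (Ioo_subset_Ioo_right hx.2)))).symm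

/-- The Lagrange identity. -/
theorem IsJet.lagrange {l : ℝ} (hl : 0 < l) {F F' h G G' k : ℝ → ℂ} (hF : IsJet l F F' h)
    (hG : IsJet l G G' k) :
    (∫ x in Ioo 0 l, h x * G x) - ∫ x in Ioo 0 l, k x * F x
      = F' l * G l - F l * G' l - (F' 0 * G 0 - F 0 * G' 0) := by
  have h1 := integral_mul_deriv_of_primitive hl hF.integrableOn hF.primitive hG.hasDerivAt
    hG.continuous_deriv
  have h2 := integral_mul_deriv_of_primitive hl hG.integrableOn hG.primitive hF.hasDerivAt
    hF.continuous_deriv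
  have h3 : ∫ x in Ioo 0 l, G' x * F' x = ∫ x in Ioo 0 l, F' x * G' x := by
    simp_rw [mul_comm]
  linear_combination h1 - h2 + h3

/-- `f ∈ W^{2,2}(0, l)` has second weak derivative `h`. -/
def HasSecondWeakDeriv (l : ℝ) (f h : EdgeL2 l) : Prop :=
  ∃ g : EdgeL2 l, HasWeakDeriv l f g ∧ HasWeakDeriv l g h

theorem mem_W22_iff {l : ℝ} {f : EdgeL2 l} : f ∈ W22 l ↔ ∃ h, HasSecondWeakDeriv l f h := by
  constructor
  · rintro ⟨p, hp, rfl⟩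
    exact ⟨p.2.2, p.2.1, hp.1, hp.2⟩
  · rintro ⟨h, g, h1, h2⟩
    exact ⟨(f, g, h), ⟨h1, h2⟩, rfl⟩

theorem HasSecondWeakDeriv.mem {l : ℝ} {f h : EdgeL2 l} (hf : HasSecondWeakDeriv l f h) :
    f ∈ W22 l :=
  mem_W22_iff.2 ⟨h, hf⟩

theorem HasSecondWeakDeriv.unique {l : ℝ} {f h k : EdgeL2 l} (hh : HasSecondWeakDeriv l f h)
    (hk : HasSecondWeakDeriv l f k) : h = k := by
  obtain ⟨a, ha, ha'⟩ := hh
  obtain ⟨b, hb, hb'⟩ := hk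
  have : a = b := ha.unique hb
  subst this
  exact ha'.unique hb'

theorem hasSecondWeakDeriv_secondWeakDeriv {l : ℝ} (f : W22 l) :
    HasSecondWeakDeriv l f (secondWeakDeriv l f) :=
  (exists_secondWeakDeriv f).choose_spec

theorem HasSecondWeakDeriv.eq {l : ℝ} {f : W22 l} {h : EdgeL2 l}
    (hf : HasSecondWeakDeriv l f h) : secondWeakDeriv l f = h :=
  (hasSecondWeakDeriv_secondWeakDeriv f).unique hf

theorem IsJet.hasSecondWeakDeriv {l : ℝ} (hl : 0 < l) {f h : EdgeL2 l} {F F' : ℝ → ℂ}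
    (hF : IsJet l F F' h) (hf : f =ᵐ[volume.restrict (Ioo 0 l)] F) :
    HasSecondWeakDeriv l f h :=
  ⟨ofContinuous l hF.continuous_deriv,
    hasWeakDeriv_of_primitive hl hf (coeFn_ofContinuous l hF.continuous_deriv) fun x _ =>
      eq_add_integral_of_hasDerivAt hF.hasDerivAt hF.continuous_deriv x,
    hasWeakDeriv_of_primitive hl (coeFn_ofContinuous l hF.continuous_deriv) (ae_eq_refl _)
      hF.primitive⟩

theorem hasDerivAt_primitive {F : ℝ → ℂ} (hF : Continuous F) (x : ℝ) :
    HasDerivAt (fun x => ∫ t in (0 : ℝ)..x, F t) (F x) x :=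
  intervalIntegral.integral_hasDerivAt_right (hF.intervalIntegrable _ _)
    (hF.stronglyMeasurableAtFilter _ _) hF.continuousAt

theorem HasWeakDeriv.sub {l : ℝ} {f g f' g' : EdgeL2 l} (hf : HasWeakDeriv l f f')
    (hg : HasWeakDeriv l g g') : HasWeakDeriv l (f - g) (f' - g') := by
  simpa [sub_eq_add_neg] using hf.add (hg.const_smul (-1))

/-- An element of `L²(0, l)` with a weak derivative in `L²(0, l)` is the sum of a given primitive
and a constant. -/
theorem HasWeakDeriv.exists_eq_add_const {l : ℝ} (hl : 0 < l) {f g : EdgeL2 l}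
    (hf : HasWeakDeriv l f g) {G : ℝ → ℂ} (hG : Continuous G)
    (hG' : ∀ x ∈ Icc 0 l, G x = G 0 + ∫ t in (0 : ℝ)..x, g t) :
    ∃ c : ℂ, f =ᵐ[volume.restrict (Ioo 0 l)] fun x => G x + c := by
  have h1 := hf.sub (hasWeakDeriv_of_primitive hl (coeFn_ofContinuous l hG) (ae_eq_refl g) hG')
  rw [sub_self] at h1
  obtain ⟨c, hc⟩ := eq_const_of_hasWeakDeriv_zero hl h1
  refine ⟨c, ?_⟩
  rw [sub_eq_iff_eq_add] at hc
  rw [hc]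
  filter_upwards [Lp.coeFn_add (ofContinuous l (continuous_const (y := c))) (ofContinuous l hG),
    coeFn_ofContinuous l hG, coeFn_ofContinuous l (continuous_const (y := c))] with x h2 h3 h4
  rw [h2, Pi.add_apply, h3, h4, add_comm]

/-- Elements of `W^{2,2}(0, l)` are represented by jets. -/
theorem HasSecondWeakDeriv.exists_isJet {l : ℝ} (hl : 0 < l) {f h : EdgeL2 l}
    (hf : HasSecondWeakDeriv l f h) :
    ∃ F F' : ℝ → ℂ, f =ᵐ[volume.restrict (Ioo 0 l)] F ∧ IsJet l F F' h := by
  obtain ⟨g, hfg, hgh⟩ := hf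
  obtain ⟨H, hHc, -, hH⟩ := QuantumGraph.exists_primitive h
  obtain ⟨b, hb⟩ := hgh.exists_eq_add_const hl hHc hH
  have hc : Continuous fun x => H x + b := hHc.add continuous_const
  -- Integrate `h` twice; `b` and `a` are the two constants of integration.
  obtain ⟨a, ha⟩ := hfg.exists_eq_add_const hl
    (G := fun x => ∫ t in (0 : ℝ)..x, (H t + b))
    (continuous_iff_continuousAt.2 fun x => (hasDerivAt_primitive hc x).continuousAt)
    fun x hx => by simp [intervalIntegral_congr_edge hb hx]
  refine ⟨_, fun x => H x + b, ha, fun x => ?_, hc, integrableOn_edgeL2 h, fun x hx => ?_⟩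
  · simpa using (hasDerivAt_primitive hc x).add_const a
  · rw [hH x hx]; ring

/-- If the second derivative of `f` in the sense of distributions is in `L²(0, l)`, then `f` is in
`W^{2,2}(0, l)`. -/
theorem hasSecondWeakDeriv_of_forall_isTest {l : ℝ} (hl : 0 < l) {f h : EdgeL2 l}
    (hf : ∀ φ, IsTest l φ →
      ∫ x in Ioo 0 l, f x * deriv (deriv φ) x = ∫ x in Ioo 0 l, h x * φ x) :
    HasSecondWeakDeriv l f h := by
  obtain ⟨H, hHc, -, hH⟩ := QuantumGraph.exists_primitive h
  have hH' : HasWeakDeriv l (ofContinuous l hHc) h :=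
    hasWeakDeriv_of_primitive hl (coeFn_ofContinuous l hHc) (ae_eq_refl h) hH
  -- With `H` a primitive of `h`, the functional `φ ↦ ∫ f φ' + ∫ H φ` vanishes on derivatives of
  -- test functions, so it equals `c ∫ φ`. Hence `H - c` is the weak derivative of `f`.
  obtain ⟨c, hc⟩ := exists_forall_integral_eq hl
    (fun φ => (∫ x in Ioo 0 l, f x * deriv φ x) + ∫ x in Ioo 0 l, ofContinuous l hHc x * φ x)
    (fun φ ψ c hφ hψ => by
      have e : ∀ x, deriv (φ + c • ψ) x = deriv φ x + c * deriv ψ x := fun x =>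
        ((hφ.hasDerivAt x).add ((hψ.hasDerivAt x).const_smul c)).deriv
      simp only [Pi.add_apply, Pi.smul_apply, smul_eq_mul, mul_add, mul_left_comm _ c, e]
      rw [integral_add (integrable_mul_test f hφ.deriv)
          ((integrable_mul_test f hψ.deriv).const_mul c),
        integral_add (integrable_mul_test _ hφ) ((integrable_mul_test _ hψ).const_mul c),
        integral_const_mul, integral_const_mul]
      ring)
    (fun φ hφ => by rw [hf φ hφ, hH' φ hφ]; ring)
  refine ⟨ofContinuous l hHc - ofContinuous l (continuous_const (y := c)), fun φ hφ => ?_, ?_⟩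
  · rw [integral_mul_congr (Lp.coeFn_sub ..)]
    simp only [Pi.sub_apply, sub_mul]
    rw [integral_sub (integrable_mul_test _ hφ) (integrable_mul_test _ hφ),
      integral_mul_congr (coeFn_ofContinuous l (continuous_const (y := c))), integral_const_mul]
    linear_combination hc φ hφ
  · simpa using hH'.sub (hasWeakDeriv_ofContinuous_const c)

/-! ### The minimal operator on an edge -/

theorem IsTest.conj {l : ℝ} {φ : ℝ → ℂ} (hφ : IsTest l φ) : IsTest l (fun x => star (φ x)) := by
  have h : tsupport (fun x => star (φ x)) ⊆ tsupport φ :=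
    closure_mono fun x hx => by simpa using hx
  exact ⟨Complex.conjCLE.contDiff.comp hφ.smooth,
    hφ.compact.comp_left (g := fun z : ℂ => star z) (by simp), h.trans hφ.support⟩

theorem deriv_conj (φ : ℝ → ℂ) : deriv (fun x => star (φ x)) = fun x => star (deriv φ x) :=
  funext fun _ => deriv.star ..

theorem inner_eq_integral {l : ℝ} (f g : EdgeL2 l) :
    inner ℂ f g = ∫ x in Ioo 0 l, g x * star (f x) := by
  rw [L2.inner_def]
  rfl

theorem integral_mul_eq_inner {l : ℝ} (f : EdgeL2 l) {F : ℝ → ℂ} (hF : Continuous F) :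
    ∫ x in Ioo 0 l, f x * F x = inner ℂ (ofContinuous l hF.star) f := by
  rw [inner_eq_integral]
  refine integral_congr_ae ?_
  filter_upwards [coeFn_ofContinuous l hF.star] with x hx
  rw [hx, star_star]

theorem HasWeakDeriv.inner_eq {l : ℝ} {f g : EdgeL2 l} (hf : HasWeakDeriv l f g) {φ : ℝ → ℂ}
    (hφ : IsTest l φ) {a b : EdgeL2 l} (ha : a =ᵐ[volume.restrict (Ioo 0 l)] φ)
    (hb : b =ᵐ[volume.restrict (Ioo 0 l)] deriv φ) : inner ℂ b f = -inner ℂ a g := by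
  have h := hf _ hφ.conj
  rw [deriv_conj] at h
  rw [inner_eq_integral, inner_eq_integral]
  refine Eq.trans (integral_congr_ae ?_) (h.trans (congrArg Neg.neg (integral_congr_ae ?_)))
  · exact hb.mono fun x hx => by simp only [hx]
  · exact ha.mono fun x hx => by simp only [hx]

/-- Integration by parts, without boundary terms, for elements of the closure of the jets of test
functions. -/
theorem inner_eq_of_mem_closure_testJet {l : ℝ} {p : EdgeL2 l × EdgeL2 l × EdgeL2 l}
    (hp : p ∈ (testJet l).topologicalClosure) :
    (∀ f g, HasWeakDeriv l f g → inner ℂ p.2.1 f = -inner ℂ p.1 g) ∧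
      ∀ f g, HasWeakDeriv l f g → inner ℂ p.2.2 f = -inner ℂ p.2.1 g := by
  have key : closure (testJet l : Set (EdgeL2 l × EdgeL2 l × EdgeL2 l)) ⊆
      {p | (∀ f g, HasWeakDeriv l f g → inner ℂ p.2.1 f = -inner ℂ p.1 g) ∧
      ∀ f g, HasWeakDeriv l f g → inner ℂ p.2.2 f = -inner ℂ p.2.1 g} := by
    refine closure_minimal ?_ ?_
    · rintro p ⟨φ, hφ, h1, h2, h3⟩
      exact ⟨fun f g hfg => hfg.inner_eq hφ h1 h2, fun f g hfg => hfg.inner_eq hφ.deriv h2 h3⟩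
    · simp only [Set.ofPred_and, Set.ofPred_forall]
      refine IsClosed.inter ?_ ?_ <;>
      refine isClosed_iInter fun f => isClosed_iInter fun g => isClosed_iInter fun _ =>
        isClosed_eq ?_ ?_ <;> fun_prop
  exact key hp

theorem hasSecondWeakDeriv_of_mem_sobolevJet {l : ℝ} {p : EdgeL2 l × EdgeL2 l × EdgeL2 l}
    (hp : p ∈ sobolevJet l) : HasSecondWeakDeriv l p.1 p.2.2 :=
  ⟨p.2.1, hp.1, hp.2⟩

/-- Each test function imposes a condition that is continuous in the L² norms. -/
theorem isClosed_sobolevJet (l : ℝ) :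
    IsClosed (sobolevJet l : Set (EdgeL2 l × EdgeL2 l × EdgeL2 l)) := by
  have h1 : ∀ φ, IsTest l φ → Continuous fun f : EdgeL2 l => ∫ x in Ioo 0 l, f x * φ x := by
    intro φ hφ
    simp_rw [integral_mul_eq_inner _ hφ.smooth.continuous]
    fun_prop
  have h2 : ∀ u v : EdgeL2 l × EdgeL2 l × EdgeL2 l → EdgeL2 l, Continuous u → Continuous v →
      IsClosed {p | HasWeakDeriv l (u p) (v p)} := by
    intro u v hu hv
    simp only [HasWeakDeriv, Set.ofPred_forall]
    exact isClosed_iInter fun φ => isClosed_iInter fun hφ =>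
      isClosed_eq ((h1 _ hφ.deriv).comp hu) ((h1 _ hφ).comp hv).neg
  exact (h2 _ _ continuous_fst (continuous_fst.comp continuous_snd)).inter
    (h2 _ _ (continuous_fst.comp continuous_snd) (continuous_snd.comp continuous_snd))

theorem edgeMin_le_edgeMax (l : ℝ) : edgeMin l ≤ edgeMax l :=
  ⟨Submodule.map_mono inf_le_left, fun x y h => by
    have : Submodule.inclusion (Submodule.map_mono inf_le_left) x = y := Subtype.ext h
    rw [← this]
    rfl⟩

theorem edgeMax_apply_of_hasSecondWeakDeriv {l : ℝ} {f h : EdgeL2 l}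
    (hf : HasSecondWeakDeriv l f h) : edgeMax l ⟨f, hf.mem⟩ = -h :=
  congrArg Neg.neg (HasSecondWeakDeriv.eq (f := ⟨f, hf.mem⟩) hf)

theorem hasSecondWeakDeriv_edgeMax {l : ℝ} (f : (edgeMax l).domain) :
    HasSecondWeakDeriv l f (-edgeMax l f) := by
  have := hasSecondWeakDeriv_secondWeakDeriv f
  have e : -edgeMax l f = secondWeakDeriv l f := neg_neg _
  rwa [e]

theorem hasSecondWeakDeriv_edgeMin {l : ℝ} (f : (edgeMin l).domain) :
    HasSecondWeakDeriv l f (-edgeMin l f) := by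
  rw [(edgeMin_le_edgeMax l).2 (y := ⟨f, (edgeMin_le_edgeMax l).1 f.2⟩) rfl]
  exact hasSecondWeakDeriv_edgeMax ⟨(f : EdgeL2 l), (edgeMin_le_edgeMax l).1 f.2⟩

/-- Passes from the operator to jets, where the closure defining `W22zero` is taken; uniqueness of
weak derivatives makes the two descriptions agree. -/
theorem mem_graph_edgeMin_iff {l : ℝ} {q : EdgeL2 l × EdgeL2 l} :
    q ∈ (edgeMin l).graph ↔
      ∃ g, (q.1, g, -q.2) ∈ sobolevJet l ⊓ (testJet l).topologicalClosure := by
  rw [LinearPMap.mem_graph_iff]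
  constructor
  · rintro ⟨y, hy, hy'⟩
    obtain ⟨p, hp, hpf⟩ := y.2
    have h := hasSecondWeakDeriv_of_mem_sobolevJet hp.1
    have e : -edgeMin l y = p.2.2 := by
      refine (hasSecondWeakDeriv_edgeMin y).unique ?_
      rw [← hpf]
      exact h
    refine ⟨p.2.1, ?_⟩
    rw [← hy', e, ← hy, ← hpf]
    exact hp
  · rintro ⟨g, hg⟩
    refine ⟨⟨q.1, ⟨_, hg, rfl⟩⟩, rfl, ?_⟩
    have h1 := hasSecondWeakDeriv_edgeMin (l := l) ⟨q.1, ⟨_, hg, rfl⟩⟩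
    exact neg_injective (h1.unique (hasSecondWeakDeriv_of_mem_sobolevJet hg.1))

theorem IsTest.mem_graph_edgeMin {l : ℝ} (hl : 0 < l) {φ : ℝ → ℂ} (hφ : IsTest l φ) :
    (ofContinuous l hφ.smooth.continuous, -ofContinuous l hφ.deriv.deriv.smooth.continuous) ∈
      (edgeMin l).graph := by
  rw [mem_graph_edgeMin_iff]
  refine ⟨ofContinuous l hφ.deriv.smooth.continuous, ⟨?_, ?_⟩, subset_closure ?_⟩
  · exact hasWeakDeriv_ofContinuous hl hφ.smooth.continuous hφ.hasDerivAt
      hφ.deriv.smooth.continuous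
  · rw [neg_neg]
    exact hasWeakDeriv_ofContinuous hl hφ.deriv.smooth.continuous hφ.deriv.hasDerivAt
      hφ.deriv.deriv.smooth.continuous
  · refine ⟨φ, hφ, coeFn_ofContinuous l hφ.smooth.continuous,
      coeFn_ofContinuous l hφ.deriv.smooth.continuous, ?_⟩
    simp only [neg_neg]
    exact coeFn_ofContinuous ..

/-- A vector orthogonal to all test functions is a weak derivative of `0`, hence zero. -/
theorem dense_edgeMin {l : ℝ} (hl : 0 < l) : Dense ((edgeMin l).domain : Set (EdgeL2 l)) := by
  rw [Submodule.dense_iff_topologicalClosure_eq_top, Submodule.topologicalClosure_eq_top_iff,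
    Submodule.eq_bot_iff]
  intro f hf
  have h0 : HasWeakDeriv l 0 f := by
    intro φ hφ
    rw [integral_mul_congr (Lp.coeFn_zero ..), integral_mul_eq_inner f hφ.smooth.continuous,
      (Submodule.mem_orthogonal _ _).1 hf _
        (LinearPMap.mem_domain_of_mem_graph (hφ.conj.mem_graph_edgeMin hl))]
    simp
  exact h0.unique (HasWeakDeriv.zero l)

theorem edgeMin_isFormalAdjoint_edgeMax (l : ℝ) : (edgeMin l).IsFormalAdjoint (edgeMax l) := by
  intro f g
  obtain ⟨g', hg, hg'⟩ := hasSecondWeakDeriv_edgeMax g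
  obtain ⟨f', hf⟩ := mem_graph_edgeMin_iff.1 ((edgeMin l).mem_graph f)
  obtain ⟨h1, h2⟩ := inner_eq_of_mem_closure_testJet hf.2
  have e1 := h1 _ _ hg'
  have e2 := h2 _ _ hg
  simp only [inner_neg_left, inner_neg_right] at e1 e2
  linear_combination -e2 + e1

/-- Testing the adjoint relation on conjugates of test functions shows that the adjoint acts as the
distributional `-d²/dx²`; the regularity lemma puts its domain in `W22`. The other inclusion is
integration by parts on the closure of the test jets. -/
theorem edgeMin_adjoint {l : ℝ} (hl : 0 < l) : (edgeMin l).adjoint = edgeMax l := by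
  have hd := dense_edgeMin hl
  have key : ∀ f : (edgeMin l).adjoint.domain,
      HasSecondWeakDeriv l f (-(edgeMin l).adjoint f) := by
    intro f
    refine hasSecondWeakDeriv_of_forall_isTest hl fun φ hφ => ?_
    obtain ⟨y, hy, hy'⟩ :=
      (LinearPMap.mem_graph_iff _).1 (hφ.conj.mem_graph_edgeMin hl)
    have h := LinearPMap.adjoint_isFormalAdjoint hd f y
    rw [hy, hy', ← inner_conj_symm, ← inner_conj_symm (f : EdgeL2 l)] at h
    have h' := (starRingEnd ℂ).injective h
    rw [integral_mul_eq_inner _ hφ.deriv.deriv.smooth.continuous,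
      integral_mul_eq_inner _ hφ.smooth.continuous, inner_neg_right, h', inner_neg_left, neg_neg]
    simp only [deriv_conj]
  have hle : (edgeMin l).adjoint ≤ edgeMax l := by
    refine ⟨fun f hf => (key ⟨f, hf⟩).mem, fun x y hxy => ?_⟩
    have h := hasSecondWeakDeriv_edgeMax y
    rw [← hxy] at h
    exact neg_injective ((key x).unique h)
  exact le_antisymm hle ((edgeMin_isFormalAdjoint_edgeMax l).le_adjoint hd)

/-- In the absence of boundary terms, `‖f'‖² = -⟨f, f''⟩ ≤ ‖f‖ ‖f''‖`. So the map from jets to pairs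
`(f, -f'')` is bounded below on a complete space, and its range, the graph, is closed. -/
theorem isClosed_edgeMin (l : ℝ) : (edgeMin l).IsClosed := by
  let J := sobolevJet l ⊓ (testJet l).topologicalClosure
  have hJ : IsClosed (J : Set (EdgeL2 l × EdgeL2 l × EdgeL2 l)) :=
    (isClosed_sobolevJet l).inter (Submodule.isClosed_topologicalClosure _)
  have : CompleteSpace J := hJ.completeSpace_coe
  let u : J →L[ℂ] EdgeL2 l × EdgeL2 l :=
    ((ContinuousLinearMap.fst ℂ _ _).prod
      (-(ContinuousLinearMap.snd ℂ _ _ ∘L ContinuousLinearMap.snd ℂ _ _))) ∘L J.subtypeL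
  have hu : ∀ p : J, ‖p‖ ≤ (1 : NNReal) * ‖u p‖ := by
    intro p
    have h1 := (inner_eq_of_mem_closure_testJet p.2.2).1 _ _ p.2.1.2
    have h2 : ‖(p : EdgeL2 l × EdgeL2 l × EdgeL2 l).2.1‖ ^ 2 ≤ ‖u p‖ ^ 2 := by
      rw [inner_self_eq_norm_sq_to_K] at h1
      have h3 := congrArg norm h1
      rw [norm_neg, norm_pow] at h3
      simp only [Complex.coe_algebraMap, Complex.norm_real, norm_norm] at h3
      rw [h3]
      refine (norm_inner_le_norm _ _).trans ?_
      rw [sq]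
      have h4 : ‖(p : EdgeL2 l × EdgeL2 l × EdgeL2 l).2.2‖ ≤ ‖u p‖ := by
        exact (norm_neg _).symm.trans_le (norm_snd_le (u p))
      exact mul_le_mul (norm_fst_le (u p)) h4 (norm_nonneg _) (norm_nonneg _)
    have h5 : ‖(p : EdgeL2 l × EdgeL2 l × EdgeL2 l).2.1‖ ≤ ‖u p‖ :=
      le_of_sq_le_sq h2 (norm_nonneg _)
    have h4 : ‖(p : EdgeL2 l × EdgeL2 l × EdgeL2 l).2.2‖ ≤ ‖u p‖ := by
      exact (norm_neg _).symm.trans_le (norm_snd_le (u p))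
    rw [NNReal.coe_one, one_mul]
    exact max_le (norm_fst_le (u p)) (max_le h5 h4)
  have hr := (AddMonoidHomClass.antilipschitz_of_bound u hu).isClosed_range u.uniformContinuous
  have e : ((edgeMin l).graph : Set (EdgeL2 l × EdgeL2 l)) = Set.range u := by
    ext q
    rw [SetLike.mem_coe, mem_graph_edgeMin_iff]
    constructor
    · rintro ⟨g, hg⟩
      exact ⟨⟨_, hg⟩, Prod.ext rfl (neg_neg _)⟩
    · rintro ⟨p, rfl⟩
      refine ⟨p.1.2.1, ?_⟩
      have : -(u p).2 = p.1.2.2 := neg_neg _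
      rw [this]
      exact p.2
  rw [LinearPMap.IsClosed, e]
  exact hr

/-! ### Abstract boundary triplets -/

section Triplet

variable {H K : Type*} [NormedAddCommGroup H] [InnerProductSpace ℂ H]
  [NormedAddCommGroup K] [InnerProductSpace ℂ K]

theorem mem_defectSpace_iff {T : H →ₗ.[ℂ] H} {z : ℂ} {f : T.domain} :
    f ∈ defectSpace T z ↔ T f = z • (f : H) := by
  rw [defectSpace, LinearMap.mem_ker, LinearMap.sub_apply, sub_eq_zero]
  rfl

/-- Lets later arguments quantify over `T.domain` with the condition `Γ f = 0`, avoiding the nested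
domain of the restriction. -/
theorem forall_restrictKer_iff {T : H →ₗ.[ℂ] H} {Γ : T.domain →ₗ[ℂ] K} {P : H → H → Prop} :
    (∀ f : (restrictKer T Γ).domain, P f (restrictKer T Γ f)) ↔
      ∀ f : T.domain, Γ f = 0 → P f (T f) := by
  constructor
  · intro h f hf
    have hm : (f : H) ∈ (restrictKer T Γ).domain := ⟨⟨f, hf, rfl⟩, f.2⟩
    have := h ⟨f, hm⟩
    rwa [show restrictKer T Γ ⟨f, hm⟩ = T f from LinearPMap.domRestrict_apply rfl] at this
  · rintro h ⟨f, hm⟩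
    obtain ⟨g, hg, rfl⟩ := hm.1
    rw [show restrictKer T Γ ⟨_, hm⟩ = T g from LinearPMap.domRestrict_apply rfl]
    exact h g hg

theorem exists_restrictKer_iff {T : H →ₗ.[ℂ] H} {Γ : T.domain →ₗ[ℂ] K} {P : H → H → Prop} :
    (∃ f : (restrictKer T Γ).domain, P f (restrictKer T Γ f)) ↔
      ∃ f : T.domain, Γ f = 0 ∧ P f (T f) := by
  have := forall_restrictKer_iff (T := T) (Γ := Γ) (P := fun a b => ¬ P a b)
  rw [← not_iff_not]
  push Not
  exact this

theorem mem_opResolventSet_restrictKer_iff {T : H →ₗ.[ℂ] H} {Γ : T.domain →ₗ[ℂ] K} {z : ℂ} :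
    z ∈ opResolventSet (restrictKer T Γ) ↔
      (∀ g, ∃ f : T.domain, Γ f = 0 ∧ T f - z • (f : H) = g) ∧
        ∃ C : ℝ, ∀ f : T.domain, Γ f = 0 → ‖(f : H)‖ ≤ C * ‖T f - z • (f : H)‖ := by
  have h1 : ∀ C, (∀ f : (restrictKer T Γ).domain, ‖(f : H)‖ ≤ C * ‖restrictKer T Γ f - z • (f : H)‖)
      ↔ ∀ f : T.domain, Γ f = 0 → ‖(f : H)‖ ≤ C * ‖T f - z • (f : H)‖ := fun C =>
    forall_restrictKer_iff (P := fun a b => ‖a‖ ≤ C * ‖b - z • a‖)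
  have h2 : ∀ g, (∃ f : (restrictKer T Γ).domain, restrictKer T Γ f - z • (f : H) = g) ↔
      ∃ f : T.domain, Γ f = 0 ∧ T f - z • (f : H) = g := fun g =>
    exists_restrictKer_iff (P := fun a b => b - z • a = g)
  constructor
  · rintro ⟨hb, C, hC⟩
    exact ⟨fun g => (h2 g).1 (hb.2 g), C, (h1 C).1 hC⟩
  · rintro ⟨hs, C, hC⟩
    have hC' := (h1 C).2 hC
    refine ⟨⟨fun f g hfg => ?_, fun g => (h2 g).2 (hs g)⟩, C, hC'⟩
    have h3 := hC' (f - g)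
    have h4 : restrictKer T Γ (f - g) - z • ((f - g : (restrictKer T Γ).domain) : H) = 0 := by
      rw [LinearPMap.map_sub, Submodule.coe_sub, smul_sub]
      simp only at hfg
      rw [sub_sub_sub_comm, hfg, sub_self]
    rw [h4, norm_zero, mul_zero] at h3
    have h5 := norm_le_zero_iff.1 h3
    rw [Submodule.coe_sub, sub_eq_zero] at h5
    exact Subtype.ext h5

variable [CompleteSpace H]

theorem mem_graph_adjoint {A : H →ₗ.[ℂ] H} (hA : Dense (A.domain : Set H)) {g w : H}
    (hg : ∀ x : A.domain, inner ℂ w (x : H) = inner ℂ g (A x)) : (g, w) ∈ A.adjoint.graph :=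
  have h1 := LinearPMap.mem_adjoint_domain_of_exists g ⟨w, hg⟩
  (LinearPMap.mem_graph_iff _).2 ⟨⟨g, h1⟩, rfl, LinearPMap.adjoint_apply_eq hA ⟨g, h1⟩ hg⟩

/-- A boundary triplet, except that the equality of the deficiency indices is not required; it is
a consequence, see `IsPreTriplet.deficiency`. -/
structure IsPreTriplet (A T : H →ₗ.[ℂ] H) (Γ₀ Γ₁ : T.domain →ₗ[ℂ] K) : Prop where
  dense : Dense (A.domain : Set H)
  closed : A.IsClosed
  symmetric : A.IsFormalAdjoint A
  adjoint_eq : A.adjoint = T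
  bounded₀ : ∃ C : ℝ, ∀ f : T.domain, ‖Γ₀ f‖ ≤ C * (‖(f : H)‖ + ‖T f‖)
  bounded₁ : ∃ C : ℝ, ∀ f : T.domain, ‖Γ₁ f‖ ≤ C * (‖(f : H)‖ + ‖T f‖)
  green : ∀ f g : T.domain,
    inner ℂ (g : H) (T f) - inner ℂ (T g) (f : H) =
      inner ℂ (Γ₀ g) (Γ₁ f) - inner ℂ (Γ₁ g) (Γ₀ f)
  surjective : Function.Surjective (fun f : T.domain => (Γ₀ f, Γ₁ f))

namespace IsPreTriplet

variable {A T : H →ₗ.[ℂ] H} {Γ₀ Γ₁ : T.domain →ₗ[ℂ] K}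

theorem isClosed_graph (h : IsPreTriplet A T Γ₀ Γ₁) :
    IsClosed (T.graph : Set (H × H)) := by
  have := LinearPMap.adjoint_isClosed h.dense
  rwa [h.adjoint_eq] at this

theorem adjoint_inner (h : IsPreTriplet A T Γ₀ Γ₁) (f : T.domain) (x : A.domain) :
    inner ℂ (T f) (x : H) = inner ℂ (f : H) (A x) := by
  have h1 := LinearPMap.adjoint_isFormalAdjoint h.dense
  rw [h.adjoint_eq] at h1
  exact h1 f x

theorem le (h : IsPreTriplet A T Γ₀ Γ₁) : A ≤ T := by
  have := LinearPMap.IsFormalAdjoint.le_adjoint h.dense h.symmetric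
  rwa [h.adjoint_eq] at this

/-- `T` is the maximal operator which is formally adjoint to `A`. -/
theorem exists_of_forall_inner (h : IsPreTriplet A T Γ₀ Γ₁) {g w : H}
    (hg : ∀ x : A.domain, inner ℂ w (x : H) = inner ℂ g (A x)) :
    ∃ f : T.domain, (f : H) = g ∧ T f = w := by
  have h3 := mem_graph_adjoint h.dense hg
  rw [h.adjoint_eq, LinearPMap.mem_graph_iff] at h3
  exact h3

/-- By surjectivity some `f` has `Γ₀ f = 0` and `Γ₁ f = Γ₀ y`. In Green's identity for `y` and `f`
the left side vanishes because `y` lies in the domain of `A`, while the right side is `-‖Γ₀ y‖²`. -/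
theorem Γ₀_eq_zero (h : IsPreTriplet A T Γ₀ Γ₁) {x : A.domain} {y : T.domain}
    (hxy : (x : H) = y) : Γ₀ y = 0 := by
  have hT : A x = T y := h.le.2 hxy
  obtain ⟨f, hf⟩ := h.surjective (0, Γ₀ y)
  have h0 : Γ₀ f = 0 := congrArg Prod.fst hf
  have h1 : Γ₁ f = Γ₀ y := congrArg Prod.snd hf
  have h2 := h.green y f
  rw [← hT, ← hxy, h.adjoint_inner, sub_self, h0, h1, inner_zero_left, zero_sub] at h2
  exact inner_self_eq_zero.1 (neg_eq_zero.1 h2.symm)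

theorem inner_eq_of_ker (h : IsPreTriplet A T Γ₀ Γ₁) {f g : T.domain} (hf : Γ₀ f = 0)
    (hg : Γ₀ g = 0) : inner ℂ (g : H) (T f) = inner ℂ (T g) (f : H) := by
  have := h.green f g
  rw [hf, hg, inner_zero_left, inner_zero_right, sub_zero] at this
  exact sub_eq_zero.1 this

/-- On `ker Γ₀` the form `⟨f, T f⟩` is real, so `Im ⟨f, (T - z) f⟩ = -Im z ‖f‖²`; then
Cauchy-Schwarz. -/
theorem im_mul_norm_le (h : IsPreTriplet A T Γ₀ Γ₁) (z : ℂ) {f : T.domain} (hf : Γ₀ f = 0) :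
    |z.im| * ‖(f : H)‖ ≤ ‖T f - z • (f : H)‖ := by
  rcases eq_or_ne (f : H) 0 with h0 | h0
  · rw [h0]; simp
  have hpos : 0 < ‖(f : H)‖ := norm_pos_iff.2 h0
  have h1 : (inner ℂ (f : H) (T f)).im = 0 := by
    have := h.inner_eq_of_ker hf hf
    rw [← inner_conj_symm] at this
    rw [← inner_conj_symm, Complex.conj_im, Complex.conj_eq_iff_im.1 this, neg_zero]
  have h2 : (inner ℂ (f : H) (T f - z • (f : H))).im = -(z.im * ‖(f : H)‖ ^ 2) := by
    rw [inner_sub_right, inner_smul_right, inner_self_eq_norm_sq_to_K, Complex.sub_im, h1]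
    simp [← Complex.ofReal_pow]
  have h3 : |z.im| * ‖(f : H)‖ * ‖(f : H)‖ ≤ ‖T f - z • (f : H)‖ * ‖(f : H)‖ := by
    calc |z.im| * ‖(f : H)‖ * ‖(f : H)‖ = |(inner ℂ (f : H) (T f - z • (f : H))).im| := by
          rw [h2, abs_neg, abs_mul, abs_of_nonneg (sq_nonneg ‖(f : H)‖)]; ring
      _ ≤ ‖inner ℂ (f : H) (T f - z • (f : H))‖ := Complex.abs_im_le_norm _
      _ ≤ ‖(f : H)‖ * ‖T f - z • (f : H)‖ := norm_inner_le_norm _ _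
      _ = _ := mul_comm _ _
  exact le_of_mul_le_mul_right h3 hpos

/-- The range `S` of `T - z` on `ker Γ₀` is closed, by the lower bound, the closed graph of `T` and
the continuity of `Γ₀` in the graph norm. A vector orthogonal to `S` solves `T v = z̄ v` with `Γ₀ v
= 0`, so the lower bound for `z̄` kills it. -/
theorem exists_resolvent (h : IsPreTriplet A T Γ₀ Γ₁) {z : ℂ} (hz : z.im ≠ 0) (g : H) :
    ∃ f : T.domain, Γ₀ f = 0 ∧ T f - z • (f : H) = g := by
  have hz' : 0 < |z.im| := abs_pos.2 hz
  let S : Submodule ℂ H := (LinearMap.ker Γ₀).map (T.toFun - z • T.domain.subtype)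
  have hSmem : ∀ w, w ∈ S ↔ ∃ f : T.domain, Γ₀ f = 0 ∧ T f - z • (f : H) = w := fun w => Iff.rfl
  have hclosed : IsClosed (S : Set H) := by
    refine isSeqClosed_iff_isClosed.1 fun w v hw hv => ?_
    choose f hf0 hf using fun n => (hSmem _).1 (hw n)
    have hcau : CauchySeq fun n => (f n : H) := by
      have hwc := hv.cauchySeq
      rw [Metric.cauchySeq_iff] at hwc ⊢
      intro ε hε
      obtain ⟨N, hN⟩ := hwc (|z.im| * ε) (by positivity)
      refine ⟨N, fun m hm n hn => ?_⟩
      have h1 := h.im_mul_norm_le z (f := f m - f n) (by rw [map_sub, hf0, hf0, sub_self])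
      have h2 : T (f m - f n) - z • ((f m - f n : T.domain) : H) = w m - w n := by
        rw [LinearPMap.map_sub, Submodule.coe_sub, smul_sub, sub_sub_sub_comm, hf, hf]
      have h3 := hN m hm n hn
      rw [h2, Submodule.coe_sub, ← dist_eq_norm, ← dist_eq_norm] at h1
      exact lt_of_mul_lt_mul_left (h1.trans_lt h3) hz'.le
    obtain ⟨u, hu⟩ := cauchySeq_tendsto_of_complete hcau
    have hTf : Tendsto (fun n => T (f n)) atTop (𝓝 (v + z • u)) := by
      refine (hv.add (hu.const_smul z)).congr fun n => ?_
      rw [← hf n, sub_add_cancel]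
    have hg : ((u, v + z • u) : H × H) ∈ T.graph :=
      h.isClosed_graph.mem_of_tendsto (hu.prodMk_nhds hTf)
        (Eventually.of_forall fun n => T.mem_graph (f n))
    obtain ⟨y, hy, hy'⟩ := (LinearPMap.mem_graph_iff _).1 hg
    refine (hSmem _).2 ⟨y, ?_, by rw [hy', hy]; simp⟩
    obtain ⟨C, hC⟩ := h.bounded₀
    have h1 : ∀ n, ‖Γ₀ y‖ ≤ C * (‖u - f n‖ + ‖v + z • u - T (f n)‖) := by
      intro n
      have := hC (y - f n)
      rwa [map_sub, hf0, sub_zero, LinearPMap.map_sub, Submodule.coe_sub, hy', hy] at this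
    have h2 : Tendsto (fun n => C * (‖u - f n‖ + ‖v + z • u - T (f n)‖)) atTop (𝓝 0) := by
      have h3 := ((tendsto_const_nhds (x := u)).sub hu).norm
      have h4 := ((tendsto_const_nhds (x := v + z • u)).sub hTf).norm
      simpa using (h3.add h4).const_mul C
    exact norm_le_zero_iff.1 (ge_of_tendsto' h2 h1)
  have hperp : Sᗮ = ⊥ := by
    rw [Submodule.eq_bot_iff]
    intro v hv
    have hv' : ∀ f : T.domain, Γ₀ f = 0 → inner ℂ v (T f - z • (f : H)) = 0 := fun f hf =>
      (Submodule.mem_orthogonal' _ _).1 hv _ ((hSmem _).2 ⟨f, hf, rfl⟩)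
    obtain ⟨y, hy, hy'⟩ := h.exists_of_forall_inner (g := v) (w := (starRingEnd ℂ) z • v) (by
      intro x
      have hx := hv' ⟨x, h.le.1 x.2⟩ (h.Γ₀_eq_zero (x := x) rfl)
      have hT : A x = T ⟨x, h.le.1 x.2⟩ := h.le.2 rfl
      rw [inner_sub_right, ← hT, sub_eq_zero] at hx
      rw [hx, inner_smul_left, inner_smul_right, starRingEnd_self_apply])
    -- Green's identity with an `f` such that `Γ₀ f = 0`, `Γ₁ f = Γ₀ y`: orthogonality to `(T - z)
    -- f` makes the left side zero, and the right side is `‖Γ₀ y‖²`.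
    have hy0 : Γ₀ y = 0 := by
      obtain ⟨f, hf⟩ := h.surjective (0, Γ₀ y)
      have h0 : Γ₀ f = 0 := congrArg Prod.fst hf
      have h1 : Γ₁ f = Γ₀ y := congrArg Prod.snd hf
      have h2 := h.green f y
      have h3 := hv' f h0
      rw [inner_sub_right, inner_smul_right] at h3
      rw [h0, h1, hy', hy, inner_smul_left, starRingEnd_self_apply, h3, inner_zero_right,
        sub_zero] at h2
      exact inner_self_eq_zero.1 h2.symm
    have h1 := h.im_mul_norm_le ((starRingEnd ℂ) z) hy0
    rw [hy', hy, sub_self, norm_zero, Complex.conj_im, abs_neg] at h1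
    exact norm_le_zero_iff.1 (le_of_mul_le_mul_left (by rwa [mul_zero]) hz')
  have hS : S = ⊤ := by
    have h1 := (Submodule.topologicalClosure_eq_top_iff (K := S)).2 hperp
    rwa [hclosed.submodule_topologicalClosure_eq] at h1
  exact (hSmem g).1 (hS ▸ Submodule.mem_top)

/-- Nonreal numbers are in the resolvent set of the restriction to `ker Γ₀`. -/
theorem mem_opResolventSet (h : IsPreTriplet A T Γ₀ Γ₁) {z : ℂ} (hz : z.im ≠ 0) :
    z ∈ opResolventSet (restrictKer T Γ₀) := by
  refine mem_opResolventSet_restrictKer_iff.2 ⟨h.exists_resolvent hz, |z.im|⁻¹, fun f hf => ?_⟩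
  rw [← div_eq_inv_mul, le_div_iff₀' (abs_pos.2 hz)]
  exact h.im_mul_norm_le z hf

/-- For nonreal `z`, an inverse of the restriction of `T - z` to `ker Γ₀`. -/
theorem exists_resolvent_linearMap (h : IsPreTriplet A T Γ₀ Γ₁) {z : ℂ} (hz : z.im ≠ 0) :
    ∃ R : H →ₗ[ℂ] T.domain, (∀ g, Γ₀ (R g) = 0 ∧ T (R g) = g + z • (R g : H)) ∧
      ∀ f, Γ₀ f = 0 → R (T f - z • (f : H)) = f := by
  have hinj : ∀ f g : T.domain, Γ₀ f = 0 → Γ₀ g = 0 →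
      T f - z • (f : H) = T g - z • (g : H) → f = g := by
    intro f g hf hg hfg
    have h1 := h.im_mul_norm_le z (f := f - g) (by rw [map_sub, hf, hg, sub_self])
    rw [LinearPMap.map_sub, Submodule.coe_sub, smul_sub, sub_sub_sub_comm, hfg, sub_self,
      norm_zero] at h1
    exact Subtype.ext (sub_eq_zero.1 (norm_le_zero_iff.1
      (le_of_mul_le_mul_left (by rwa [mul_zero]) (abs_pos.2 hz))))
  choose R hR0 hR using h.exists_resolvent hz
  refine ⟨⟨⟨R, fun a b => ?_⟩, fun c a => ?_⟩, fun g => ⟨hR0 g, ?_⟩, fun f hf => ?_⟩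
  · refine hinj _ _ (hR0 _) (by rw [map_add, hR0, hR0, add_zero]) ?_
    rw [hR, LinearPMap.map_add, Submodule.coe_add, smul_add, add_sub_add_comm, hR, hR]
  · refine hinj _ _ (hR0 _) (by rw [map_smul, hR0, smul_zero]) ?_
    rw [hR, RingHom.id_apply, LinearPMap.map_smul, Submodule.coe_smul, smul_comm z c, ← smul_sub,
      hR]
  · exact sub_eq_iff_eq_add.1 (hR g)
  · exact hinj _ _ (hR0 _) hf (hR _)

/-- The deficiency indices are equal: the Cayley transform of the restriction to `ker Γ₀` maps one
defect space onto the other. -/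
theorem deficiency (h : IsPreTriplet A T Γ₀ Γ₁) :
    Nonempty (defectSpace T Complex.I ≃ₗᵢ[ℂ] defectSpace T (-Complex.I)) := by
  obtain ⟨R, hR, hR'⟩ := h.exists_resolvent_linearMap (z := -Complex.I) (by simp)
  obtain ⟨S, hS, hS'⟩ := h.exists_resolvent_linearMap (z := Complex.I) (by simp)
  -- `U = I - 2i (A₀ + i)⁻¹` is the Cayley transform `(A₀ - i)(A₀ + i)⁻¹`, and `W` is its inverse;
  -- both resolvents take values in `T.domain`.
  let U : T.domain →ₗ[ℂ] T.domain :=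
    LinearMap.id - (2 * Complex.I) • (R ∘ₗ T.domain.subtype)
  let W : T.domain →ₗ[ℂ] T.domain :=
    LinearMap.id + (2 * Complex.I) • (S ∘ₗ T.domain.subtype)
  have hUc : ∀ f, U f = f - (2 * Complex.I) • R f := fun f => rfl
  have hWc : ∀ f, W f = f + (2 * Complex.I) • S f := fun f => rfl
  have hU : ∀ f ∈ defectSpace T Complex.I, U f ∈ defectSpace T (-Complex.I) := by
    intro f hf
    rw [mem_defectSpace_iff] at hf ⊢
    rw [hUc, LinearPMap.map_sub, LinearPMap.map_smul, (hR _).2, hf, Submodule.coe_sub,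
      Submodule.coe_smul]
    module
  have hW : ∀ f ∈ defectSpace T (-Complex.I), W f ∈ defectSpace T Complex.I := by
    intro f hf
    rw [mem_defectSpace_iff] at hf ⊢
    rw [hWc, LinearPMap.map_add, LinearPMap.map_smul, (hS _).2, hf, Submodule.coe_add,
      Submodule.coe_smul]
    module
  -- Because `U f = (T - i) R f`, and `S` inverts `T - i` on `ker Γ₀`.
  have hSU : ∀ f, S (U f) = R f := by
    intro f
    have h1 := hS' (R f) (hR _).1
    rw [(hR _).2] at h1
    rw [← h1]
    congr 1
    rw [hUc, Submodule.coe_sub, Submodule.coe_smul]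
    module
  have hRW : ∀ f, R (W f) = S f := by
    intro f
    have h1 := hR' (S f) (hS _).1
    rw [(hS _).2] at h1
    rw [← h1]
    congr 1
    rw [hWc, Submodule.coe_add, Submodule.coe_smul]
    module
  have hnorm : ∀ f, ‖U f‖ = ‖f‖ := by
    intro f
    have h1 := h.inner_eq_of_ker (hR f).1 (hR f).1
    rw [(hR _).2, inner_add_left, inner_add_right, inner_smul_left, inner_smul_right] at h1
    have h2 : inner ℂ (U f : H) (U f : H) = inner ℂ (f : H) (f : H) := by
      rw [hUc, Submodule.coe_sub, Submodule.coe_smul]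
      simp only [inner_sub_left, inner_sub_right, inner_smul_left, inner_smul_right, map_mul,
        map_neg, Complex.conj_I, map_ofNat] at h1 ⊢
      linear_combination (2 * Complex.I) * h1
    rw [inner_self_eq_norm_sq_to_K, inner_self_eq_norm_sq_to_K] at h2
    have h3 : ‖(U f : H)‖ ^ 2 = ‖(f : H)‖ ^ 2 := by exact_mod_cast h2
    exact (sq_eq_sq₀ (norm_nonneg _) (norm_nonneg _)).1 h3
  refine ⟨⟨LinearEquiv.ofLinearMap (U.restrict hU) (W.restrict hW) ?_ ?_, fun f => hnorm f⟩⟩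
  · ext f
    change ((U (W f) : T.domain) : H) = f
    rw [hUc, hRW, hWc, add_sub_cancel_right]
  · ext f
    change ((W (U f) : T.domain) : H) = f
    rw [hWc, hSU, hUc, sub_add_cancel]

theorem isBoundaryTriplet [CompleteSpace K] (h : IsPreTriplet A T Γ₀ Γ₁) :
    IsBoundaryTriplet A T Γ₀ Γ₁ :=
  ⟨h.dense, h.closed, h.symmetric, h.adjoint_eq, h.deficiency, inferInstance, h.bounded₀,
    h.bounded₁, h.green, h.surjective⟩

theorem completeSpace_defectSpace (h : IsPreTriplet A T Γ₀ Γ₁) (z : ℂ) :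
    CompleteSpace (defectSpace T z) := by
  refine Metric.complete_of_cauchySeq_tendsto fun u hu => ?_
  have hu' : CauchySeq fun n => ((u n : T.domain) : H) :=
    (uniformContinuous_subtype_val.comp uniformContinuous_subtype_val).comp_cauchySeq hu
  obtain ⟨v, hv⟩ := cauchySeq_tendsto_of_complete hu'
  have hg : ((v, z • v) : H × H) ∈ T.graph := by
    refine h.isClosed_graph.mem_of_tendsto (hv.prodMk_nhds (hv.const_smul z))
      (Eventually.of_forall fun n => ?_)
    rw [← mem_defectSpace_iff.1 (u n).2]
    exact T.mem_graph _
  obtain ⟨y, hy, hy'⟩ := (LinearPMap.mem_graph_iff _).1 hg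
  simp only at hy hy'
  refine ⟨⟨y, mem_defectSpace_iff.2 (by rw [hy', hy])⟩, ?_⟩
  rw [tendsto_subtype_rng, tendsto_subtype_rng]
  simpa only [hy] using hv

/-- The domain of `T` is the direct sum of `ker Γ₀` and `ker (T - z)`: any preimage `f` of `k` is
corrected by the `w ∈ ker Γ₀` with `(T - z) w = (T - z) f`. -/
theorem bijective_Γ₀ (h : IsPreTriplet A T Γ₀ Γ₁) {z : ℂ}
    (hz : z ∈ opResolventSet (restrictKer T Γ₀)) :
    Function.Bijective (fun f : defectSpace T z => Γ₀ f) := by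
  obtain ⟨hs, C, hC⟩ := mem_opResolventSet_restrictKer_iff.1 hz
  constructor
  · intro f g hfg
    have h1 := hC (f - g : defectSpace T z) (by
      rw [Submodule.coe_sub, map_sub]
      exact sub_eq_zero.2 hfg)
    rw [mem_defectSpace_iff.1 (f - g).2, sub_self, norm_zero, mul_zero] at h1
    exact sub_eq_zero.1 (Subtype.ext (Subtype.ext (norm_le_zero_iff.1 h1)))
  · intro k
    obtain ⟨f, hf⟩ := h.surjective (k, 0)
    obtain ⟨w, hw, hw'⟩ := hs (T f - z • (f : H))
    refine ⟨⟨f - w, mem_defectSpace_iff.2 ?_⟩, ?_⟩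
    · rw [LinearPMap.map_sub, Submodule.coe_sub, smul_sub]
      exact sub_eq_sub_iff_sub_eq_sub.2 hw'.symm
    · change Γ₀ (f - w) = k
      rw [map_sub, hw, sub_zero]
      exact congrArg Prod.fst hf

/-- A boundary triplet has a Weyl function. -/
theorem exists_isWeylFunction [CompleteSpace K] (h : IsPreTriplet A T Γ₀ Γ₁) :
    ∃ M, IsWeylFunction T Γ₀ Γ₁ M := by
  -- On `ker (T - z)` the graph norm is `(1 + ‖z‖)` times the norm of `H`.
  have hb : ∀ Γ : T.domain →ₗ[ℂ] K,
      (∃ C : ℝ, ∀ f : T.domain, ‖Γ f‖ ≤ C * (‖(f : H)‖ + ‖T f‖)) →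
      ∀ z, ∃ G : defectSpace T z →L[ℂ] K, ∀ f, G f = Γ f := by
    rintro Γ ⟨C, hC⟩ z
    refine ⟨(Γ ∘ₗ (defectSpace T z).subtype).mkContinuous (C * (1 + ‖z‖)) fun f => ?_, fun f => rfl⟩
    refine (hC f).trans (le_of_eq ?_)
    rw [mem_defectSpace_iff.1 f.2, norm_smul]
    change C * (‖f‖ + ‖z‖ * ‖f‖) = _
    ring
  have hM : ∀ z : opResolventSet (restrictKer T Γ₀), ∃ M : K →L[ℂ] K,
      ∀ f : defectSpace T z, M (Γ₀ f) = Γ₁ f := by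
    intro z
    have := h.completeSpace_defectSpace z
    obtain ⟨G₀, hG₀⟩ := hb Γ₀ h.bounded₀ z
    obtain ⟨G₁, hG₁⟩ := hb Γ₁ h.bounded₁ z
    have hbij : Function.Bijective G₀ := by
      have := h.bijective_Γ₀ z.2
      rwa [← funext hG₀] at this
    let e := ContinuousLinearEquiv.ofBijective G₀ (LinearMap.ker_eq_bot.2 hbij.1)
      (LinearMap.range_eq_top.2 hbij.2)
    refine ⟨G₁ ∘L (e.symm : K →L[ℂ] defectSpace T z), fun f => ?_⟩
    have : Γ₀ f = e f := (hG₀ f).symm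
    rw [this]
    change G₁ (e.symm (e f)) = _
    rw [e.symm_apply_apply, hG₁]
  choose M hM using hM
  exact ⟨M, fun z => ⟨h.bijective_Γ₀ z.2, hM z⟩⟩

end IsPreTriplet

end Triplet

/-! ### Direct sums of boundary triplets -/

section DirectSumTriplet

variable {ι : Type*} {H K : ι → Type*}
  [∀ i, NormedAddCommGroup (H i)] [∀ i, InnerProductSpace ℂ (H i)]
  [∀ i, NormedAddCommGroup (K i)] [∀ i, InnerProductSpace ℂ (K i)]

/-- Square summability of the images is already contained in `q.2` being an element of `lp`, so on
graphs everything is componentwise. -/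
theorem mem_graph_directSum_iff {T : ∀ i, H i →ₗ.[ℂ] K i} {q : lp H 2 × lp K 2} :
    q ∈ (directSum T).graph ↔ ∀ i, (q.1 i, q.2 i) ∈ (T i).graph := by
  rw [LinearPMap.mem_graph_iff]
  constructor
  · rintro ⟨y, hy, hy'⟩ i
    rw [← hy, ← hy']
    exact (T i).mem_graph ⟨(y : lp H 2) i, y.2.choose i⟩
  · intro h
    choose y hy hy' using fun i => (LinearPMap.mem_graph_iff _).1 (h i)
    have hd : ∀ i, q.1 i ∈ (T i).domain := fun i => LinearPMap.mem_domain_of_mem_graph (h i)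
    have e : ∀ i, T i ⟨q.1 i, hd i⟩ = q.2 i := fun i => by
      refine Eq.trans (congrArg _ (Subtype.ext ?_)) (hy' i)
      exact (hy i).symm
    have hm : q.1 ∈ (directSum T).domain := ⟨hd, by
      simp only [e]
      exact lp.memℓp q.2⟩
    exact ⟨⟨q.1, hm⟩, rfl, lp.ext (funext e)⟩

theorem directSum_component_mem {T : ∀ i, H i →ₗ.[ℂ] K i} (f : (directSum T).domain) (i : ι) :
    (f : lp H 2) i ∈ (T i).domain :=
  f.2.choose i

theorem memℓp_of_le {E F G : ι → Type*} [∀ i, NormedAddCommGroup (E i)]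
    [∀ i, NormedAddCommGroup (F i)] [∀ i, NormedAddCommGroup (G i)] {C : ℝ} (f : lp F 2)
    (g : lp G 2) {u : ∀ i, E i} (h : ∀ i, ‖u i‖ ≤ C * (‖f i‖ + ‖g i‖)) : Memℓp u 2 :=
  (((lp.memℓp f).norm.add (lp.memℓp g).norm).const_mul C).mono h

theorem norm_le_of_le {E F G : ι → Type*} [∀ i, NormedAddCommGroup (E i)]
    [∀ i, NormedAddCommGroup (F i)] [∀ i, NormedAddCommGroup (G i)] {C : ℝ} (hC : 0 ≤ C)
    {f : lp F 2} {g : lp G 2} {u : lp E 2} (h : ∀ i, ‖u i‖ ≤ C * (‖f i‖ + ‖g i‖)) :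
    ‖u‖ ≤ C * (‖f‖ + ‖g‖) := by
  have h1 : ‖u‖ ≤ ‖C • (lp.toNorm f + lp.toNorm g)‖ := by
    refine lp.norm_mono (by norm_num) fun i => (h i).trans (Real.le_norm_self _)
  refine h1.trans ?_
  rw [norm_smul, Real.norm_of_nonneg hC]
  refine mul_le_mul_of_nonneg_left ((norm_add_le _ _).trans ?_) hC
  rw [lp.norm_toNorm, lp.norm_toNorm]

/-- The direct sum of uniformly bounded linear maps on the domains of the operators `T i`. -/
def directSumMap {T : ∀ i, H i →ₗ.[ℂ] H i} (Γ : ∀ i, (T i).domain →ₗ[ℂ] K i) {C : ℝ}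
    (hΓ : ∀ i (f : (T i).domain), ‖Γ i f‖ ≤ C * (‖(f : H i)‖ + ‖T i f‖)) :
    (directSum T).domain →ₗ[ℂ] lp K 2 where
  toFun f := ⟨fun i => Γ i ⟨(f : lp H 2) i, directSum_component_mem f i⟩,
    memℓp_of_le (f : lp H 2) (directSum T f) fun i => hΓ i _⟩
  map_add' f g := by
    ext i
    exact (Γ i).map_add ⟨(f : lp H 2) i, directSum_component_mem f i⟩
      ⟨(g : lp H 2) i, directSum_component_mem g i⟩
  map_smul' c f := by
    ext i
    exact (Γ i).map_smul c ⟨(f : lp H 2) i, directSum_component_mem f i⟩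

theorem directSumMap_apply {T : ∀ i, H i →ₗ.[ℂ] H i} (Γ : ∀ i, (T i).domain →ₗ[ℂ] K i) {C : ℝ}
    (hΓ : ∀ i (f : (T i).domain), ‖Γ i f‖ ≤ C * (‖(f : H i)‖ + ‖T i f‖))
    (f : (directSum T).domain) (i : ι) :
    directSumMap Γ hΓ f i = Γ i ⟨(f : lp H 2) i, directSum_component_mem f i⟩ :=
  rfl

theorem norm_directSumMap_le {T : ∀ i, H i →ₗ.[ℂ] H i} (Γ : ∀ i, (T i).domain →ₗ[ℂ] K i) {C : ℝ}
    (hC : 0 ≤ C) (hΓ : ∀ i (f : (T i).domain), ‖Γ i f‖ ≤ C * (‖(f : H i)‖ + ‖T i f‖))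
    (f : (directSum T).domain) :
    ‖directSumMap Γ hΓ f‖ ≤ C * (‖(f : lp H 2)‖ + ‖directSum T f‖) :=
  norm_le_of_le hC fun _ => hΓ _ _

theorem single_mem_graph_directSum [DecidableEq ι] {T : ∀ i, H i →ₗ.[ℂ] K i} (i : ι)
    (x : (T i).domain) :
    (lp.single 2 i (x : H i), lp.single 2 i (T i x)) ∈ (directSum T).graph := by
  refine mem_graph_directSum_iff.2 fun j => ?_
  rcases eq_or_ne j i with rfl | hj
  · simp
  · simp only [lp.single_apply_ne 2 i _ hj]
    exact (T j).graph.zero_mem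

theorem isClosed_directSum {T : ∀ i, H i →ₗ.[ℂ] K i} (h : ∀ i, (T i).IsClosed) :
    (directSum T).IsClosed := by
  have e : ((directSum T).graph : Set (lp H 2 × lp K 2)) =
      ⋂ i, (fun q => (lp.evalCLM ℂ H 2 i q.1, lp.evalCLM ℂ K 2 i q.2)) ⁻¹'
        ((T i).graph : Set (H i × K i)) := by
    ext q
    rw [SetLike.mem_coe, mem_graph_directSum_iff, mem_iInter]
    rfl
  rw [LinearPMap.IsClosed, e]
  exact isClosed_iInter fun i => (h i).preimage (by fun_prop)

theorem directSum_isFormalAdjoint {S T : ∀ i, H i →ₗ.[ℂ] H i}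
    (h : ∀ i, (S i).IsFormalAdjoint (T i)) : (directSum S).IsFormalAdjoint (directSum T) := by
  intro f g
  rw [lp.inner_eq_tsum, lp.inner_eq_tsum]
  exact tsum_congr fun i => h i ⟨(f : lp H 2) i, directSum_component_mem f i⟩
    ⟨(g : lp H 2) i, directSum_component_mem g i⟩

variable [∀ i, CompleteSpace (H i)]

theorem dense_directSum {T : ∀ i, H i →ₗ.[ℂ] K i} (h : ∀ i, Dense ((T i).domain : Set (H i))) :
    Dense ((directSum T).domain : Set (lp H 2)) := by
  classical
  rw [Submodule.dense_iff_topologicalClosure_eq_top, Submodule.topologicalClosure_eq_top_iff,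
    Submodule.eq_bot_iff]
  intro f hf
  ext i
  refine (h i).eq_zero_of_inner_right ℂ fun {x} hx => ?_
  have h1 := (Submodule.mem_orthogonal _ _).1 hf _
    (LinearPMap.mem_domain_of_mem_graph (single_mem_graph_directSum i ⟨x, hx⟩))
  rwa [lp.inner_single_left] at h1

/-- Testing the adjoint relation on vectors supported in one component recovers the adjoint relation
of that component. -/
theorem directSum_adjoint {A T : ∀ i, H i →ₗ.[ℂ] H i}
    (hd : ∀ i, Dense ((A i).domain : Set (H i))) (h : ∀ i, (A i).adjoint = T i) :
    (directSum A).adjoint = directSum T := by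
  classical
  refine le_antisymm (LinearPMap.le_of_le_graph fun q hq => ?_)
    (LinearPMap.IsFormalAdjoint.le_adjoint (dense_directSum (T := A) hd) (directSum_isFormalAdjoint
      fun i => h i ▸ (LinearPMap.adjoint_isFormalAdjoint (hd i)).symm))
  refine mem_graph_directSum_iff.2 fun i => ?_
  obtain ⟨f, hf, hf'⟩ := (LinearPMap.mem_graph_iff _).1 hq
  have h1 : ∀ x : (A i).domain, inner ℂ (q.2 i) (x : H i) = inner ℂ (q.1 i) (A i x) := by
    intro x
    have h0 := single_mem_graph_directSum (T := A) i x
    rw [LinearPMap.mem_graph_iff] at h0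
    obtain ⟨y, hy, hy'⟩ := h0
    have h2 := LinearPMap.adjoint_isFormalAdjoint (dense_directSum (T := A) hd) f y
    rwa [hy, hy', hf, hf', lp.inner_single_right, lp.inner_single_right] at h2
  rw [← h i]
  exact mem_graph_adjoint (hd i) h1

/-- The direct sum of boundary triplets which are uniformly bounded and have uniformly bounded right
inverses. -/
theorem IsPreTriplet.directSum {A T : ∀ i, H i →ₗ.[ℂ] H i} {Γ₀ Γ₁ : ∀ i, (T i).domain →ₗ[ℂ] K i}
    (h : ∀ i, IsPreTriplet (A i) (T i) (Γ₀ i) (Γ₁ i)) {C₀ C₁ C : ℝ} (hC₀ : 0 ≤ C₀) (hC₁ : 0 ≤ C₁)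
    (hΓ₀ : ∀ i (f : (T i).domain), ‖Γ₀ i f‖ ≤ C₀ * (‖(f : H i)‖ + ‖T i f‖))
    (hΓ₁ : ∀ i (f : (T i).domain), ‖Γ₁ i f‖ ≤ C₁ * (‖(f : H i)‖ + ‖T i f‖))
    (hsurj : ∀ i (a b : K i), ∃ f : (T i).domain, Γ₀ i f = a ∧ Γ₁ i f = b ∧
      ‖(f : H i)‖ ≤ C * (‖a‖ + ‖b‖) ∧ ‖T i f‖ ≤ C * (‖a‖ + ‖b‖)) :
    IsPreTriplet (QuantumGraph.directSum A) (QuantumGraph.directSum T) (directSumMap Γ₀ hΓ₀)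
      (directSumMap Γ₁ hΓ₁) where
  dense := dense_directSum fun i => (h i).dense
  closed := isClosed_directSum fun i => (h i).closed
  symmetric := directSum_isFormalAdjoint fun i => (h i).symmetric
  adjoint_eq := directSum_adjoint (fun i => (h i).dense) fun i => (h i).adjoint_eq
  bounded₀ := ⟨C₀, norm_directSumMap_le Γ₀ hC₀ hΓ₀⟩
  bounded₁ := ⟨C₁, norm_directSumMap_le Γ₁ hC₁ hΓ₁⟩
  green f g := by
    have h1 := (lp.hasSum_inner (𝕜 := ℂ) (g : lp H 2) (QuantumGraph.directSum T f)).sub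
      (lp.hasSum_inner (𝕜 := ℂ) (QuantumGraph.directSum T g) (f : lp H 2))
    have h2 := (lp.hasSum_inner (𝕜 := ℂ) (directSumMap Γ₀ hΓ₀ g) (directSumMap Γ₁ hΓ₁ f)).sub
      (lp.hasSum_inner (𝕜 := ℂ) (directSumMap Γ₁ hΓ₁ g) (directSumMap Γ₀ hΓ₀ f))
    refine h1.unique ?_
    convert h2 using 2 with i
    exact (h i).green ⟨(f : lp H 2) i, directSum_component_mem f i⟩
      ⟨(g : lp H 2) i, directSum_component_mem g i⟩
  surjective := by
    rintro ⟨a, b⟩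
    choose f hf₀ hf₁ hf hTf using fun i => hsurj i (a i) (b i)
    -- The uniform constant `C` makes the chosen preimages and their images square summable.
    obtain ⟨y, hy, hy'⟩ := (LinearPMap.mem_graph_iff _).1 (mem_graph_directSum_iff (T := T)
      (q := (⟨fun i => f i, memℓp_of_le a b hf⟩, ⟨fun i => T i (f i), memℓp_of_le a b hTf⟩)) |>.2
      fun i => (T i).mem_graph (f i))
    have e : ∀ i, (⟨(y : lp H 2) i, directSum_component_mem y i⟩ : (T i).domain) = f i := fun i =>
      Subtype.ext (congrArg (fun v : lp H 2 => v i) hy)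
    refine ⟨y, Prod.ext (lp.ext (funext fun i => ?_)) (lp.ext (funext fun i => ?_))⟩
    · simp only [directSumMap_apply, e, hf₀]
    · simp only [directSumMap_apply, e, hf₁]

end DirectSumTriplet

/-! ### Cubic polynomials on an edge -/

/-- A cubic polynomial, as a complex function of a real variable. -/
def cubic (a b c d : ℂ) (x : ℝ) : ℂ := a + b * x + c * (x : ℂ) ^ 2 + d * (x : ℂ) ^ 3

theorem continuous_cubic (a b c d : ℂ) : Continuous (cubic a b c d) := by
  unfold cubic
  fun_prop

theorem hasDerivAt_cubic (a b c d : ℂ) (x : ℝ) :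
    HasDerivAt (cubic a b c d) (cubic b (2 * c) (3 * d) 0 x) x := by
  have h1 : HasDerivAt (fun x : ℝ => (x : ℂ)) 1 x := Complex.ofRealCLM.hasDerivAt
  have h := (((h1.const_mul b).const_add a).add ((h1.pow 2).const_mul c)).add
    ((h1.pow 3).const_mul d)
  convert! h using 1
  simp only [cubic]
  push_cast
  ring

theorem isJet_cubic (l : ℝ) (a b c d : ℂ) :
    IsJet l (cubic a b c d) (cubic b (2 * c) (3 * d) 0) (cubic (2 * c) (6 * d) 0 0) := by
  refine IsJet.of_hasDerivAt l (hasDerivAt_cubic a b c d) (fun x => ?_) (continuous_cubic _ _ _ _)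
  convert hasDerivAt_cubic b (2 * c) (3 * d) 0 x using 2 <;> ring

theorem norm_cubic_le (a b c d : ℂ) {l x : ℝ} (hx : x ∈ Ioo 0 l) :
    ‖cubic a b c d x‖ ≤ ‖a‖ + ‖b‖ * l + ‖c‖ * l ^ 2 + ‖d‖ * l ^ 3 := by
  have hx0 := hx.1.le
  have hxl := hx.2.le
  have e : ‖(x : ℂ)‖ = x := by rw [Complex.norm_real, Real.norm_of_nonneg hx0]
  refine norm_add₄_le.trans ?_
  simp only [norm_mul, norm_pow, e]
  gcongr

/-- The linear functional `f ↦ ∫ f P` on `L²(0, l)`, for a cubic polynomial `P`. -/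
def cubicPairing (l : ℝ) (a b c d : ℂ) : EdgeL2 l →ₗ[ℂ] ℂ :=
  (innerSL ℂ (ofContinuous l (continuous_cubic a b c d).star)).toLinearMap

theorem cubicPairing_apply {l : ℝ} (a b c d : ℂ) (f : EdgeL2 l) :
    cubicPairing l a b c d f = ∫ x in Ioo 0 l, f x * cubic a b c d x :=
  (integral_mul_eq_inner f (continuous_cubic a b c d)).symm

theorem norm_ofContinuous_cubic_le {l : ℝ} (hl : 0 ≤ l) (a b c d : ℂ) :
    ‖ofContinuous l (continuous_cubic a b c d)‖ ≤
      √l * (‖a‖ + ‖b‖ * l + ‖c‖ * l ^ 2 + ‖d‖ * l ^ 3) :=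
  norm_ofContinuous_le hl _ (by positivity) fun _ hx => norm_cubic_le a b c d hx

theorem norm_cubicPairing_le {l : ℝ} (hl : 0 ≤ l) (a b c d : ℂ) (f : EdgeL2 l) :
    ‖cubicPairing l a b c d f‖ ≤ √l * (‖a‖ + ‖b‖ * l + ‖c‖ * l ^ 2 + ‖d‖ * l ^ 3) * ‖f‖ := by
  refine (norm_inner_le_norm (𝕜 := ℂ) _ f).trans
    (mul_le_mul_of_nonneg_right ?_ (norm_nonneg f))
  refine norm_ofContinuous_le hl _ (by positivity) fun x hx => ?_
  rw [norm_star]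
  exact norm_cubic_le a b c d hx

/-- The linear functional `f ↦ ∫ (f'' P - f P'')` on `W^{2,2}(0, l)`, for a cubic polynomial `P`. By
the Lagrange identity it only depends on the boundary values of `f` and `f'`. -/
def boundaryFunctional (l : ℝ) (a b c d : ℂ) : (edgeMax l).domain →ₗ[ℂ] ℂ :=
  -(cubicPairing l a b c d ∘ₗ (edgeMax l).toFun) -
    cubicPairing l (2 * c) (6 * d) 0 0 ∘ₗ (edgeMax l).domain.subtype

theorem boundaryFunctional_apply {l : ℝ} (a b c d : ℂ) (f : (edgeMax l).domain) :
    boundaryFunctional l a b c d f =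
      cubicPairing l a b c d (-edgeMax l f) - cubicPairing l (2 * c) (6 * d) 0 0 f := by
  rw [map_neg]
  rfl

theorem norm_boundaryFunctional_le {l : ℝ} (hl : 0 ≤ l) (a b c d : ℂ) (f : (edgeMax l).domain) :
    ‖boundaryFunctional l a b c d f‖ ≤
      √l * (‖a‖ + ‖b‖ * l + ‖c‖ * l ^ 2 + ‖d‖ * l ^ 3) * ‖edgeMax l f‖ +
        √l * (2 * ‖c‖ + 6 * ‖d‖ * l) * ‖(f : EdgeL2 l)‖ := by
  rw [boundaryFunctional_apply]
  refine (norm_sub_le _ _).trans (add_le_add ?_ ?_)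
  · simpa using norm_cubicPairing_le hl a b c d (-edgeMax l f)
  · simpa using norm_cubicPairing_le hl (2 * c) (6 * d) 0 0 (f : EdgeL2 l)

/-- The jet `(F, F')` represents `f ∈ W^{2,2}(0, l)`. -/
structure Represents (l : ℝ) (f : (edgeMax l).domain) (F F' : ℝ → ℂ) : Prop where
  ae_eq : (f : EdgeL2 l) =ᵐ[volume.restrict (Ioo 0 l)] F
  isJet : IsJet l F F' (-edgeMax l f : EdgeL2 l)

theorem exists_represents {l : ℝ} (hl : 0 < l) (f : (edgeMax l).domain) :
    ∃ F F' : ℝ → ℂ, Represents l f F F' := by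
  obtain ⟨F, F', h1, h2⟩ := (hasSecondWeakDeriv_edgeMax f).exists_isJet hl
  exact ⟨F, F', h1, h2⟩

theorem Represents.lagrange {l : ℝ} (hl : 0 < l) {f : (edgeMax l).domain} {F F' : ℝ → ℂ}
    (hf : Represents l f F F') {G G' k : ℝ → ℂ} (hG : IsJet l G G' k) :
    (∫ x in Ioo 0 l, (-edgeMax l f : EdgeL2 l) x * G x) - ∫ x in Ioo 0 l, (f : EdgeL2 l) x * k x
      = F' l * G l - F l * G' l - (F' 0 * G 0 - F 0 * G' 0) := by
  rw [← hf.isJet.lagrange hl hG, integral_mul_congr hf.ae_eq]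
  simp_rw [mul_comm (F _)]

theorem Represents.boundaryFunctional_eq {l : ℝ} (hl : 0 < l) {f : (edgeMax l).domain}
    {F F' : ℝ → ℂ} (hf : Represents l f F F') (a b c d : ℂ) :
    boundaryFunctional l a b c d f =
      F' l * cubic a b c d l - F l * cubic b (2 * c) (3 * d) 0 l - (F' 0 * a - F 0 * b) := by
  rw [boundaryFunctional_apply, cubicPairing_apply, cubicPairing_apply,
    hf.lagrange hl (isJet_cubic l a b c d)]
  simp [cubic]

/-- A cubic polynomial, as an element of `W^{2,2}(0, l)`. -/
theorem exists_represents_cubic {l : ℝ} (hl : 0 < l) (a b c d : ℂ) :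
    ∃ f : (edgeMax l).domain, Represents l f (cubic a b c d) (cubic b (2 * c) (3 * d) 0) ∧
      (f : EdgeL2 l) = ofContinuous l (continuous_cubic a b c d) ∧
      edgeMax l f = -ofContinuous l (continuous_cubic (2 * c) (6 * d) 0 0) := by
  have hj := (isJet_cubic l a b c d).congr (coeFn_ofContinuous l (continuous_cubic _ _ _ _)).symm
  have h := hj.hasSecondWeakDeriv hl (coeFn_ofContinuous l (continuous_cubic a b c d))
  have e := edgeMax_apply_of_hasSecondWeakDeriv h
  refine ⟨⟨_, h.mem⟩, ⟨coeFn_ofContinuous l (continuous_cubic a b c d), ?_⟩, rfl, e⟩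
  rw [e, neg_neg]
  exact hj

/-! ### The boundary triplet of an edge -/

/-- The regularized boundary values `√l (f(0), f(l))` on an edge. -/
def edgeΓ₀ (l : ℝ) : (edgeMax l).domain →ₗ[ℂ] EuclideanSpace ℂ (Fin 2) :=
  (WithLp.linearEquiv 2 ℂ (Fin 2 → ℂ)).symm.toLinearMap ∘ₗ LinearMap.pi
    -- The cubics `x (1 - x/l)²` and `x² (l - x)/l²` vanish at both endpoints. The first has
    -- derivative `1` at `0` and `0` at `l`, the second `0` at `0` and `-1` at `l`, so the
    -- functionals are `f(0)` and `f(l)`.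
    ![(√l : ℂ) • boundaryFunctional l 0 1 (-2 / l) (1 / (l : ℂ) ^ 2),
      (√l : ℂ) • boundaryFunctional l 0 0 (1 / l) (-1 / (l : ℂ) ^ 2)]

/-- The regularized boundary derivatives on an edge. -/
def edgeΓ₁ (l : ℝ) : (edgeMax l).domain →ₗ[ℂ] EuclideanSpace ℂ (Fin 2) :=
  (WithLp.linearEquiv 2 ℂ (Fin 2 → ℂ)).symm.toLinearMap ∘ₗ LinearMap.pi
    -- The affine functions `1 - x/l` and `x/l` isolate one boundary derivative each; their slopes
    -- supply the term with `Q_e`.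
    ![(-(√l : ℂ)⁻¹) • boundaryFunctional l 1 (-1 / l) 0 0,
      (-(√l : ℂ)⁻¹) • boundaryFunctional l 0 (1 / l) 0 0]

theorem edgeΓ₀_apply {l : ℝ} (f : (edgeMax l).domain) :
    edgeΓ₀ l f = !₂[(√l : ℂ) * boundaryFunctional l 0 1 (-2 / l) (1 / (l : ℂ) ^ 2) f,
      (√l : ℂ) * boundaryFunctional l 0 0 (1 / l) (-1 / (l : ℂ) ^ 2) f] := by
  ext i
  fin_cases i <;> rfl

theorem edgeΓ₁_apply {l : ℝ} (f : (edgeMax l).domain) :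
    edgeΓ₁ l f = !₂[-(√l : ℂ)⁻¹ * boundaryFunctional l 1 (-1 / l) 0 0 f,
      -(√l : ℂ)⁻¹ * boundaryFunctional l 0 (1 / l) 0 0 f] := by
  ext i
  fin_cases i <;> rfl

theorem Represents.edgeΓ₀_eq {l : ℝ} (hl : 0 < l) {f : (edgeMax l).domain} {F F' : ℝ → ℂ}
    (hf : Represents l f F F') : edgeΓ₀ l f = !₂[(√l : ℂ) * F 0, (√l : ℂ) * F l] := by
  have hl' : (l : ℂ) ≠ 0 := Complex.ofReal_ne_zero.2 hl.ne'
  rw [edgeΓ₀_apply, hf.boundaryFunctional_eq hl, hf.boundaryFunctional_eq hl]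
  congr 5 <;> simp only [cubic] <;> field_simp <;> ring

theorem Represents.edgeΓ₁_eq {l : ℝ} (hl : 0 < l) {f : (edgeMax l).domain} {F F' : ℝ → ℂ}
    (hf : Represents l f F F') :
    edgeΓ₁ l f = !₂[(√l : ℂ)⁻¹ * (F' 0 - (F l - F 0) / l),
      (√l : ℂ)⁻¹ * (-F' l - (F 0 - F l) / l)] := by
  have hl' : (l : ℂ) ≠ 0 := Complex.ofReal_ne_zero.2 hl.ne'
  rw [edgeΓ₁_apply, hf.boundaryFunctional_eq hl, hf.boundaryFunctional_eq hl]
  have e1 : F' l * cubic 1 (-1 / l) 0 0 l - F l * cubic (-1 / l) (2 * 0) (3 * 0) 0 l -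
      (F' 0 * 1 - F 0 * (-1 / l)) = -(F' 0 - (F l - F 0) / l) := by
    simp only [cubic]; field_simp; ring
  have e2 : F' l * cubic 0 (1 / l) 0 0 l - F l * cubic (1 / l) (2 * 0) (3 * 0) 0 l -
      (F' 0 * 0 - F 0 * (1 / l)) = -(-F' l - (F 0 - F l) / l) := by
    simp only [cubic]; field_simp; ring
  rw [e1, e2, neg_mul_neg, neg_mul_neg]

theorem norm_euclidean_two_le (a b : ℂ) : ‖(!₂[a, b] : EuclideanSpace ℂ (Fin 2))‖ ≤ ‖a‖ + ‖b‖ := by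
  rw [EuclideanSpace.norm_eq, Real.sqrt_le_iff]
  refine ⟨by positivity, ?_⟩
  simp only [Fin.sum_univ_two]
  change ‖a‖ ^ 2 + ‖b‖ ^ 2 ≤ _
  nlinarith [norm_nonneg a, norm_nonneg b]

theorem norm_edgeΓ₀_le {l L : ℝ} (hl : 0 < l) (hL : l ≤ L) (f : (edgeMax l).domain) :
    ‖edgeΓ₀ l f‖ ≤ (18 + 6 * L ^ 2) * (‖(f : EdgeL2 l)‖ + ‖edgeMax l f‖) := by
  have hs : √l * √l = l := Real.mul_self_sqrt hl.le
  have h1 := norm_boundaryFunctional_le hl.le 0 1 (-2 / l) (1 / (l : ℂ) ^ 2) f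
  have h2 := norm_boundaryFunctional_le hl.le 0 0 (1 / l) (-1 / (l : ℂ) ^ 2) f
  simp only [norm_zero, norm_one, norm_div, norm_neg, norm_pow, Complex.norm_real,
    Real.norm_of_nonneg hl.le, Complex.norm_ofNat] at h1 h2
  rw [edgeΓ₀_apply]
  refine (norm_euclidean_two_le _ _).trans ?_
  rw [norm_mul, norm_mul, Complex.norm_real, Real.norm_of_nonneg (Real.sqrt_nonneg l)]
  have h3 := mul_le_mul_of_nonneg_left (add_le_add h1 h2) (Real.sqrt_nonneg l)
  rw [mul_add] at h3
  refine h3.trans ?_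
  have e : √l * (√l * (0 + 1 * l + 2 / l * l ^ 2 + 1 / l ^ 2 * l ^ 3) * ‖edgeMax l f‖ +
      √l * (2 * (2 / l) + 6 * (1 / l ^ 2) * l) * ‖(f : EdgeL2 l)‖ +
      (√l * (0 + 0 * l + 1 / l * l ^ 2 + 1 / l ^ 2 * l ^ 3) * ‖edgeMax l f‖ +
      √l * (2 * (1 / l) + 6 * (1 / l ^ 2) * l) * ‖(f : EdgeL2 l)‖)) =
      (√l * √l) * ((6 * l) * ‖edgeMax l f‖ + 18 / l * ‖(f : EdgeL2 l)‖) := by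
    field_simp
    ring
  rw [e, hs]
  have e2 : l * ((6 * l) * ‖edgeMax l f‖ + 18 / l * ‖(f : EdgeL2 l)‖) =
      6 * l ^ 2 * ‖edgeMax l f‖ + 18 * ‖(f : EdgeL2 l)‖ := by
    field_simp
  rw [e2, mul_add, add_comm]
  gcongr
  · linarith [sq_nonneg L]
  · have : l ^ 2 ≤ L ^ 2 := by gcongr
    linarith

theorem norm_edgeΓ₁_le {l : ℝ} (hl : 0 < l) (f : (edgeMax l).domain) :
    ‖edgeΓ₁ l f‖ ≤ 3 * (‖(f : EdgeL2 l)‖ + ‖edgeMax l f‖) := by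
  have hs : 0 < √l := Real.sqrt_pos.2 hl
  have h1 := norm_boundaryFunctional_le hl.le 1 (-1 / l) 0 0 f
  have h2 := norm_boundaryFunctional_le hl.le 0 (1 / l) 0 0 f
  simp only [norm_zero, norm_one, norm_div, norm_neg, Complex.norm_real,
    Real.norm_of_nonneg hl.le] at h1 h2
  rw [edgeΓ₁_apply]
  refine (norm_euclidean_two_le _ _).trans ?_
  rw [norm_mul, norm_mul, norm_neg, norm_inv, Complex.norm_real, Real.norm_of_nonneg hs.le]
  have h3 := mul_le_mul_of_nonneg_left (add_le_add h1 h2) (inv_nonneg.2 hs.le)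
  rw [mul_add] at h3
  refine h3.trans ?_
  have e : (√l)⁻¹ * (√l * (1 + 1 / l * l + 0 * l ^ 2 + 0 * l ^ 3) * ‖edgeMax l f‖ +
      √l * (2 * 0 + 6 * 0 * l) * ‖(f : EdgeL2 l)‖ +
      (√l * (0 + 1 / l * l + 0 * l ^ 2 + 0 * l ^ 3) * ‖edgeMax l f‖ +
      √l * (2 * 0 + 6 * 0 * l) * ‖(f : EdgeL2 l)‖)) = 3 * ‖edgeMax l f‖ := by
    field_simp
    ring
  rw [e, mul_add]
  linarith [norm_nonneg (f : EdgeL2 l)]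

/-- The uniformly bounded right inverse. The affine part of the interpolant carries `a` and has no
second derivative, so `‖f''‖` involves only `b`, with no power of `l`. -/
theorem exists_edgeΓ_eq {l L : ℝ} (hl : 0 < l) (hL : l ≤ L) (a b : EuclideanSpace ℂ (Fin 2)) :
    ∃ f : (edgeMax l).domain, edgeΓ₀ l f = a ∧ edgeΓ₁ l f = b ∧
      ‖(f : EdgeL2 l)‖ ≤ (18 + 6 * L ^ 2) * (‖a‖ + ‖b‖) ∧
      ‖edgeMax l f‖ ≤ (18 + 6 * L ^ 2) * (‖a‖ + ‖b‖) := by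
  have hl' : (l : ℂ) ≠ 0 := Complex.ofReal_ne_zero.2 hl.ne'
  have hs : 0 < √l := Real.sqrt_pos.2 hl
  have hs' : (√l : ℂ) ≠ 0 := Complex.ofReal_ne_zero.2 hs.ne'
  have hss : √l * √l = l := Real.mul_self_sqrt hl.le
  have hL2 : l ^ 2 ≤ L ^ 2 := by gcongr
  have ha0 := PiLp.norm_apply_le a 0
  have ha1 := PiLp.norm_apply_le a 1
  have hb0 := PiLp.norm_apply_le b 0
  have hb1 := PiLp.norm_apply_le b 1
  -- The affine interpolant of the values `a / √l`, plus the cubic vanishing at both endpoints with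
  -- inward derivatives `√l b 0` and `√l b 1`.
  obtain ⟨f, hf, hf1, hf2⟩ := exists_represents_cubic hl ((√l : ℂ)⁻¹ * a 0)
    ((√l : ℂ)⁻¹ * (a 1 - a 0) / l + √l * b 0) (√l * (b 1 - 2 * b 0) / l)
    (√l * (b 0 - b 1) / (l : ℂ) ^ 2)
  have n1 : ‖b 1 - 2 * b 0‖ ≤ ‖b 1‖ + 2 * ‖b 0‖ := by
    refine (norm_sub_le _ _).trans ?_
    simp
  have n2 := norm_sub_le (b 0) (b 1)
  have n3 := norm_sub_le (a 1) (a 0)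
  refine ⟨f, ?_, ?_, ?_, ?_⟩
  · rw [hf.edgeΓ₀_eq hl]
    ext i
    fin_cases i
    · simp [cubic, hs']
    · simp only [cubic]
      change _ = a 1
      simp only [Fin.mk_one, Fin.isValue, Matrix.cons_val_one, Matrix.cons_val_fin_one]
      field_simp
      ring
  · rw [hf.edgeΓ₁_eq hl]
    ext i
    fin_cases i
    · change (√l : ℂ)⁻¹ * _ = b 0
      simp only [cubic]
      field_simp
      push_cast
      ring
    · change (√l : ℂ)⁻¹ * _ = b 1
      simp only [cubic]
      field_simp
      push_cast
      ring
  · rw [hf1]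
    refine (norm_ofContinuous_cubic_le hl.le _ _ _ _).trans ?_
    have m1 : ‖(√l : ℂ)⁻¹ * (a 1 - a 0) / l + √l * b 0‖ ≤
        (√l)⁻¹ * (‖a 1‖ + ‖a 0‖) / l + √l * ‖b 0‖ := by
      refine (norm_add_le _ _).trans ?_
      simp only [norm_mul, norm_div, norm_inv, Complex.norm_real, Real.norm_of_nonneg hl.le,
        Real.norm_of_nonneg hs.le]
      gcongr
    simp only [norm_mul, norm_div, norm_inv, norm_pow, Complex.norm_real,
      Real.norm_of_nonneg hl.le, Real.norm_of_nonneg hs.le] at m1 ⊢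
    calc _ ≤ √l * ((√l)⁻¹ * ‖a 0‖ + ((√l)⁻¹ * (‖a 1‖ + ‖a 0‖) / l + √l * ‖b 0‖) * l +
          √l * (‖b 1‖ + 2 * ‖b 0‖) / l * l ^ 2 + √l * (‖b 0‖ + ‖b 1‖) / l ^ 2 * l ^ 3) := by
          gcongr
      _ = 2 * ‖a 0‖ + ‖a 1‖ + (√l * √l) * l * (4 * ‖b 0‖ + 2 * ‖b 1‖) := by
          field_simp
          ring
      _ ≤ (18 + 6 * L ^ 2) * ‖a‖ + L ^ 2 * (6 * ‖b‖) := by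
          rw [hss, ← sq]
          gcongr
          · nlinarith [norm_nonneg a, sq_nonneg L, mul_nonneg (sq_nonneg L) (norm_nonneg a)]
          · linarith
      _ ≤ _ := by nlinarith [norm_nonneg b]
  · rw [hf2, norm_neg]
    refine (norm_ofContinuous_cubic_le hl.le _ _ _ _).trans ?_
    simp only [norm_mul, norm_div, norm_pow, Complex.norm_real, norm_zero,
      Real.norm_of_nonneg hl.le, Real.norm_of_nonneg hs.le, Complex.norm_ofNat, zero_mul, add_zero]
    calc _ ≤ √l * (2 * (√l * (‖b 1‖ + 2 * ‖b 0‖) / l) +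
          6 * (√l * (‖b 0‖ + ‖b 1‖) / l ^ 2) * l) := by gcongr
      _ = (√l * √l) / l * (10 * ‖b 0‖ + 8 * ‖b 1‖) := by
          field_simp
          ring
      _ ≤ 18 * ‖b‖ := by
          rw [hss, div_self hl.ne', one_mul]
          linarith
      _ ≤ _ := by
          nlinarith [norm_nonneg a, norm_nonneg b, mul_nonneg (sq_nonneg L) (norm_nonneg a),
            mul_nonneg (sq_nonneg L) (norm_nonneg b)]

/-- The Lagrange identity with the conjugate of `g`: the factors `√l` cancel, and so do the terms
with `Q_e`, which is real and symmetric. -/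
theorem edge_green {l : ℝ} (hl : 0 < l) (f g : (edgeMax l).domain) :
    inner ℂ (g : EdgeL2 l) (edgeMax l f) - inner ℂ (edgeMax l g) (f : EdgeL2 l) =
      inner ℂ (edgeΓ₀ l g) (edgeΓ₁ l f) - inner ℂ (edgeΓ₁ l g) (edgeΓ₀ l f) := by
  obtain ⟨F, F', hF⟩ := exists_represents hl f
  obtain ⟨G, G', hG⟩ := exists_represents hl g
  have h := hF.lagrange hl hG.isJet.conj
  have e1 : inner ℂ (g : EdgeL2 l) (-edgeMax l f) =
      ∫ x in Ioo 0 l, (-edgeMax l f : EdgeL2 l) x * star (G x) := by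
    rw [inner_eq_integral]
    exact integral_congr_ae (hG.ae_eq.mono fun x hx => by simp only [hx])
  rw [← e1, ← inner_eq_integral, inner_neg_left, inner_neg_right] at h
  have hs' : (√l : ℂ) ≠ 0 := Complex.ofReal_ne_zero.2 (Real.sqrt_pos.2 hl).ne'
  have hl' : (l : ℂ) ≠ 0 := Complex.ofReal_ne_zero.2 hl.ne'
  rw [hF.edgeΓ₀_eq hl, hG.edgeΓ₀_eq hl, hF.edgeΓ₁_eq hl, hG.edgeΓ₁_eq hl]
  simp only [PiLp.inner_apply, Fin.sum_univ_two, Matrix.cons_val_zero,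
    Matrix.cons_val_one, RCLike.inner_apply, map_mul, map_sub, map_div₀, map_inv₀, map_neg,
    Complex.conj_ofReal]
  simp only [Complex.star_def] at h
  field_simp
  linear_combination (-(l : ℂ)) * h

/-- The boundary triplet of an edge. -/
theorem isPreTriplet_edge {l : ℝ} (hl : 0 < l) :
    IsPreTriplet (edgeMin l) (edgeMax l) (edgeΓ₀ l) (edgeΓ₁ l) where
  dense := dense_edgeMin hl
  closed := isClosed_edgeMin l
  symmetric f g := by
    rw [(edgeMin_le_edgeMax l).2 (y := ⟨g, (edgeMin_le_edgeMax l).1 g.2⟩) rfl]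
    exact edgeMin_isFormalAdjoint_edgeMax l f ⟨g, (edgeMin_le_edgeMax l).1 g.2⟩
  adjoint_eq := edgeMin_adjoint hl
  bounded₀ := ⟨_, norm_edgeΓ₀_le hl le_rfl⟩
  bounded₁ := ⟨_, norm_edgeΓ₁_le hl⟩
  green := edge_green hl
  surjective := by
    rintro ⟨a, b⟩
    obtain ⟨f, h0, h1, -⟩ := exists_edgeΓ_eq hl le_rfl a b
    exact ⟨f, Prod.ext h0 h1⟩

/-! ### Traces -/

theorem Represents.hasTraces {l : ℝ} {f : (edgeMax l).domain} {F F' : ℝ → ℂ}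
    (hf : Represents l f F F') : HasTraces l f ![F 0, F l] ![F' 0, -F' l] := by
  have hc := hf.isJet.continuous
  refine ⟨F, hc.continuousOn, hf.ae_eq, (hc.tendsto 0).mono_left nhdsWithin_le_nhds,
    (hc.tendsto l).mono_left nhdsWithin_le_nhds, ?_, ?_⟩
  · have h := (hasDerivAt_iff_tendsto_slope.1 (hf.isJet.hasDerivAt 0)).mono_left
      (nhdsWithin_mono 0 fun x (hx : 0 < x) => hx.ne')
    refine h.congr' ?_
    filter_upwards [self_mem_nhdsWithin] with x (hx : 0 < x)
    rw [slope_def_module, sub_zero, abs_of_pos hx, Complex.real_smul, Complex.ofReal_inv,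
      div_eq_inv_mul]
    rfl
  · have h := ((hasDerivAt_iff_tendsto_slope.1 (hf.isJet.hasDerivAt l)).mono_left
      (nhdsWithin_mono l fun x (hx : x < l) => hx.ne)).neg
    refine h.congr' ?_
    filter_upwards [self_mem_nhdsWithin] with x (hx : x < l)
    rw [slope_def_module, abs_of_neg (sub_neg.2 hx), Complex.real_smul, Complex.ofReal_inv,
      div_eq_inv_mul, Complex.ofReal_neg, inv_neg, neg_mul]
    rfl

/-! ### The Weyl function of an edge -/

/-- Two solutions of `u'' = -s² u` have the same Wronskian at both endpoints. -/
theorem Represents.weyl {l : ℝ} (hl : 0 < l) {f : (edgeMax l).domain} {F F' : ℝ → ℂ}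
    (hf : Represents l f F F') {s : ℂ} (hs : edgeMax l f = s ^ 2 • (f : EdgeL2 l))
    {G G' k : ℝ → ℂ} (hG : IsJet l G G' k) (hk : ∀ x, k x = -s ^ 2 * G x) :
    F' l * G l - F l * G' l = F' 0 * G 0 - F 0 * G' 0 := by
  have h := hf.lagrange hl hG
  have e : ∫ x in Ioo 0 l, (-edgeMax l f : EdgeL2 l) x * G x
      = ∫ x in Ioo 0 l, (f : EdgeL2 l) x * k x := by
    refine integral_congr_ae ?_
    rw [hs, ← neg_smul]
    filter_upwards [Lp.coeFn_smul (-s ^ 2) (f : EdgeL2 l)] with x hx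
    rw [hx, hk, Pi.smul_apply, smul_eq_mul]
    ring
  rw [e, sub_self] at h
  exact sub_eq_zero.1 h.symm

theorem isJet_sin (l : ℝ) (s c : ℂ) :
    IsJet l (fun x : ℝ => Complex.sin (s * x + c)) (fun x : ℝ => s * Complex.cos (s * x + c))
      (fun x : ℝ => -s ^ 2 * Complex.sin (s * x + c)) := by
  have h1 : ∀ x : ℂ, HasDerivAt (fun x => s * x + c) s x := fun x => by
    simpa using ((hasDerivAt_id x).const_mul s).add_const c
  refine IsJet.of_hasDerivAt l (fun x => ?_) (fun x => ?_) (by fun_prop)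
  · convert (h1 x).csin.comp_ofReal using 1
    ring
  · convert ((h1 x).ccos.const_mul s).comp_ofReal using 1
    ring

theorem Represents.deriv_eq {l : ℝ} (hl : 0 < l) {f : (edgeMax l).domain} {F F' : ℝ → ℂ}
    (hf : Represents l f F F') {s : ℂ} (hs : edgeMax l f = s ^ 2 • (f : EdgeL2 l))
    (hsin : Complex.sin (l * s) ≠ 0) :
    F' 0 = s * (-Complex.cot (l * s) * F 0 + 1 / Complex.sin (l * s) * F l) ∧
      -F' l = s * (1 / Complex.sin (l * s) * F 0 - Complex.cot (l * s) * F l) := by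
  -- `sin (s x)` vanishes at `0`, which leaves `F' l`; `sin (s (x - l))` vanishes at `l`, which
  -- leaves `F' 0`.
  have h1 := hf.weyl hl hs (isJet_sin l s 0) fun x => rfl
  have h2 := hf.weyl hl hs (isJet_sin l s (-(l * s))) fun x => rfl
  rw [mul_comm s l] at h1 h2
  simp only [Complex.ofReal_zero, mul_zero, add_zero, zero_add, Complex.sin_zero, Complex.cos_zero,
    add_neg_cancel, Complex.sin_neg, Complex.cos_neg, mul_one] at h1 h2
  rw [Complex.cot_eq_cos_div_sin]
  generalize Complex.sin (l * s) = S at *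
  generalize Complex.cos (l * s) = C at *
  constructor
  · field_simp
    linear_combination h2
  · field_simp
    linear_combination -h1

/-- The zeros of the complex sine are real. -/
theorem sin_ne_zero_of_sq_im_ne_zero {s : ℂ} (hs : (s ^ 2).im ≠ 0) {l : ℝ} (hl : l ≠ 0) :
    Complex.sin (l * s) ≠ 0 := by
  intro h
  obtain ⟨k, hk⟩ := Complex.sin_eq_zero_iff.1 h
  have hl' : (l : ℂ) ≠ 0 := Complex.ofReal_ne_zero.2 hl
  have : s = ((k * Real.pi / l : ℝ) : ℂ) := by
    push_cast
    rw [← hk]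
    field_simp
  apply hs
  rw [this, ← Complex.ofReal_pow, Complex.ofReal_im]

/-! ### Matrix form of the edge boundary maps and Weyl functions -/

namespace MetricGraph

variable {V E : Type*} (G : MetricGraph V E)

theorem _root_.Matrix.mulVec_two (a b c d x y : ℂ) :
    !![a, b; c, d] *ᵥ ![x, y] = ![a * x + b * y, c * x + d * y] := by
  ext i
  fin_cases i
  · exact Fin.sum_univ_two fun j => !![a, b; c, d] 0 j * ![x, y] j
  · exact Fin.sum_univ_two fun j => !![a, b; c, d] 1 j * ![x, y] j

theorem R_inv (e : E) :
    (G.R e)⁻¹ = ((√(G.length e) : ℂ)⁻¹) • (1 : Matrix (Fin 2) (Fin 2) ℂ) := by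
  have hs : (√(G.length e) : ℂ) ≠ 0 :=
    Complex.ofReal_ne_zero.2 (Real.sqrt_pos.2 (G.length_pos e)).ne'
  refine Matrix.inv_eq_left_inv ?_
  rw [R, smul_mul_smul_comm, inv_mul_cancel₀ hs, one_smul, mul_one]

theorem edgeΓ₀_eq_R_mulVec (e : E) {f : (edgeMax (G.length e)).domain} {F F' : ℝ → ℂ}
    (hf : Represents (G.length e) f F F') :
    edgeΓ₀ (G.length e) f = WithLp.toLp 2 (G.R e *ᵥ ![F 0, F (G.length e)]) := by
  rw [hf.edgeΓ₀_eq (G.length_pos e), R, Matrix.smul_mulVec, Matrix.one_mulVec]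
  congr 1
  ext i
  fin_cases i <;> rfl

theorem edgeΓ₁_eq_mulVec (e : E) {f : (edgeMax (G.length e)).domain} {F F' : ℝ → ℂ}
    (hf : Represents (G.length e) f F F') :
    edgeΓ₁ (G.length e) f = WithLp.toLp 2 ((G.R e)⁻¹ *ᵥ (![F' 0, -F' (G.length e)] -
      G.Q e *ᵥ ![F 0, F (G.length e)])) := by
  rw [hf.edgeΓ₁_eq (G.length_pos e), R_inv, Matrix.smul_mulVec, Matrix.one_mulVec, Q,
    Matrix.smul_mulVec, Matrix.mulVec_two]
  congr 1
  ext i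
  fin_cases i
  · change _ = _ * (F' 0 - 1 / (G.length e : ℂ) * (-1 * F 0 + 1 * F (G.length e)))
    change (√(G.length e) : ℂ)⁻¹ * (F' 0 - (F (G.length e) - F 0) / G.length e) = _
    ring
  · change _ = _ * (-F' (G.length e) - 1 / (G.length e : ℂ) * (1 * F 0 + -1 * F (G.length e)))
    change (√(G.length e) : ℂ)⁻¹ * (-F' (G.length e) - (F 0 - F (G.length e)) / G.length e) = _
    ring

/-- Only the square of `z ^ (1 / 2)` enters the argument, so the choice of branch is immaterial. -/
theorem edgeΓ₁_eq_weylReg_mulVec (e : E) {z : ℂ} (hz : z.im ≠ 0)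
    {f : (edgeMax (G.length e)).domain}
    (hf : edgeMax (G.length e) f = z • (f : EdgeL2 (G.length e))) :
    edgeΓ₁ (G.length e) f =
      WithLp.toLp 2 (G.weylReg e z *ᵥ (edgeΓ₀ (G.length e) f).ofLp) := by
  have hl := G.length_pos e
  obtain ⟨F, F', hF⟩ := exists_represents hl f
  have hs2 : (z ^ (1 / 2 : ℂ)) ^ 2 = z := by
    rw [one_div]
    exact Complex.cpow_nat_inv_pow z two_ne_zero
  have hsin : Complex.sin (G.length e * z ^ (1 / 2 : ℂ)) ≠ 0 :=
    sin_ne_zero_of_sq_im_ne_zero (by rwa [hs2]) hl.ne'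
  obtain ⟨h0, h1⟩ := hF.deriv_eq hl (s := z ^ (1 / 2 : ℂ)) (by rw [hs2, hf]) hsin
  have hM : ![F' 0, -F' (G.length e)] = G.weylZero e z *ᵥ ![F 0, F (G.length e)] := by
    rw [h0, h1, weylZero, Matrix.smul_mulVec, Matrix.mulVec_two, Matrix.smul_cons, Matrix.smul_cons,
      Matrix.smul_empty, smul_eq_mul, smul_eq_mul, neg_mul, sub_eq_add_neg, neg_mul]
  have hR : IsUnit (G.R e).det := by
    rw [R, Matrix.det_smul]
    simp [hl.le, hl.ne']
  rw [G.edgeΓ₁_eq_mulVec e hF, G.edgeΓ₀_eq_R_mulVec e hF, hM, ← Matrix.sub_mulVec, weylReg,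
    Matrix.mulVec_mulVec, Matrix.mulVec_mulVec, Matrix.mul_assoc _ _ (G.R e),
    Matrix.nonsing_inv_mul _ hR, Matrix.mul_one]

end MetricGraph

end

end QuantumGraph

/-! ### The theorem for the whole graph -/

open QuantumGraph
theorem theorem2p2 {V E : Type*} [Countable V] [Countable E] (G : MetricGraph V E)
    (hsup : BddAbove (Set.range G.length)) :
    ∃ Γ₀ Γ₁ : G.Hmax.domain →ₗ[ℂ] G.BoundarySpace,
      (∀ (f : G.Hmax.domain) (e : E), ∃ u u' : Fin 2 → ℂ,
        HasTraces (G.length e) ((f : G.L2) e) u u' ∧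
        Γ₀ f e = WithLp.toLp 2 (G.R e *ᵥ u) ∧
        Γ₁ f e = WithLp.toLp 2 ((G.R e)⁻¹ *ᵥ (u' - G.Q e *ᵥ u))) ∧
      IsBoundaryTriplet G.Hmin G.Hmax Γ₀ Γ₁ ∧
      ∃ M : opResolventSet (restrictKer G.Hmax Γ₀) → (G.BoundarySpace →L[ℂ] G.BoundarySpace),
        IsWeylFunction G.Hmax Γ₀ Γ₁ M ∧
        ∀ z : ℂ, z.im ≠ 0 → ∃ hz : z ∈ opResolventSet (restrictKer G.Hmax Γ₀),
          ∀ (x : G.BoundarySpace) (e : E),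
            M ⟨z, hz⟩ x e = WithLp.toLp 2 (G.weylReg e z *ᵥ (x e).ofLp) := by
  obtain ⟨L, hL⟩ := hsup
  have hL' : ∀ e, G.length e ≤ L := fun e => hL ⟨e, rfl⟩
  have hΓ₀ := fun e => norm_edgeΓ₀_le (G.length_pos e) (hL' e)
  have hΓ₁ := fun e => norm_edgeΓ₁_le (G.length_pos e)
  have h := IsPreTriplet.directSum (fun e => isPreTriplet_edge (G.length_pos e))
    (by positivity) (by norm_num) hΓ₀ hΓ₁ fun e => exists_edgeΓ_eq (G.length_pos e) (hL' e)
  refine ⟨directSumMap _ hΓ₀, directSumMap _ hΓ₁, fun f e => ?_, h.isBoundaryTriplet, ?_⟩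
  · obtain ⟨F, F', hF⟩ := exists_represents (G.length_pos e) ⟨_, directSum_component_mem f e⟩
    exact ⟨_, _, hF.hasTraces, G.edgeΓ₀_eq_R_mulVec e hF, G.edgeΓ₁_eq_mulVec e hF⟩
  · obtain ⟨M, hM⟩ := h.exists_isWeylFunction
    refine ⟨M, hM, fun z hz => ⟨h.mem_opResolventSet hz, fun x e => ?_⟩⟩
    obtain ⟨hbij, hMz⟩ := hM ⟨z, h.mem_opResolventSet hz⟩
    -- Every `x` is `Γ₀ f` with `f ∈ ker (T - z)`, whose components solve the equation on each edge;
    -- this reduces the formula to a single edge.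
    obtain ⟨f, rfl⟩ := hbij.2 x
    refine (congrArg (fun v : G.BoundarySpace => v e) (hMz f)).trans ?_
    have hf := mem_defectSpace_iff.1 f.2
    exact G.edgeΓ₁_eq_weylReg_mulVec e hz (congrArg (fun v : G.L2 => v e) hf)
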